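/- Let $a,b,c:\mathbb R\to\mathbb R$ be smooth and let $m:\mathbb R^2\to\mathbb C$ be smooth and compactly supported. Write $\widehat f(\xi)=(2\pi)^{-1/2}\int e^{-ix\xi}f(x)\,dx$ for the Fourier transform on $L^2(\mathbb R)$, $p(D)$ for the Fourier multiplier with symbol $p$, $\langle x\rangle=\sqrt{1+x^2}$, $\|f\|_{L^{2,s}}=\|\langle x\rangle^s f\|_{L^2}$, and let $T_m(f,g)$ be the function with Fourier transform $\xi\mapsto\int m(\xi-\eta,\eta)\widehat f(\xi-\eta)\widehat g(\eta)\,d\eta$. For $f,g\in L^2(\mathbb R)$ let $u,v,w:[0,\infty)\to L^2(\mathbb R)$ solve $$ i\partial_t u+a(D)u=T_m(v,w),\qquad i\partial_t v+b(D)v=0,\qquad i\partial_t w+c(D)w=0, $$ $$ u(0)=0,\qquad v(0)=f,\qquad w(0)=g, $$ where each equation is understood after Fourier transform in $x$, as an ordinary differential equation in $t\ge 0$ at almost every frequency $\xi$. Let $\phi(\xi,\eta)=-a(\xi+\eta)+b(\xi)+c(\eta)$ and $\Gamma=\{\phi=0\}$. Assume that on $\operatorname{Supp} m$ the function $\phi$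 vanishes to first order along $\Gamma$ (i.e. $\nabla\phi\ne0$ at every point of $\Gamma\cap\operatorname{Supp} m$, so that $\Gamma$ is a smooth curve near each such point) and that $\Gamma$ is non-characteristic there: at no point of $\Gamma\cap\operatorname{Supp} m$ is the tangent to $\Gamma$ parallel to $(1,0)$, $(0,1)$ or $(1,-1)$. Then the following bounds hold for all $t>0$ and all $f,g\in L^2(\mathbb R)$ (a bound being void when its right-hand side is infinite). 1. For every $2\le q<\infty$ and $0\le s<\frac14$ there is a constant $C$ depending only on $a,b,c,m,q,s$ such that $\|u(t)\|_{L^q}\le C\,t^{\frac{1-4s}{q}}\|f\|_{L^{2,s}}\|g\|_{L^{2,s}}$. 2. For every $2\le q<\infty$ and $s>\frac14$ there is a constant $C$ depending only on $a,b,c,m,q,s$ such that $\|u(t)\|_{L^q}\le C\,\langle\log t\rangle\|f\|_{L^{2,s}}\|g\|_{L^{2,s}}$. 3. For $q=\infty$ there is a constant $C$ depending only on $a,b,c,m$ such that $\|u(t)\|_{L^\infty}\le C\,\langle\log t\rangle\|f\|_{L^2}\|g\|_{L^2}$. -/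

import Mathlib

open MeasureTheory FourierTransform Complex
open scoped ContDiff ENNReal

noncomputable section

/-- The space `L²(ℝ; ℂ)`. -/
abbrev L2 : Type := Lp ℂ 2 (volume : Measure ℝ)

/-- The Fourier transform on `L²(ℝ)` in the angular frequency normalisation
`f̂(ξ) = (2π)^{-1/2} ∫ e^{-ixξ} f(x) dx`. Mathlib's `𝓕` is the unitary extension to `L²` of
`f ↦ ∫ e^{-2πixξ} f(x) dx`, so `f̂(ξ) = (2π)^{-1/2} (𝓕 f)(ξ / 2π)`. -/
def hat (f : L2) (ξ : ℝ) : ℂ :=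
  ((√(2 * Real.pi))⁻¹ : ℝ) * (𝓕 f : L2) (ξ / (2 * Real.pi))

/-- The Japanese bracket `⟨x⟩ = √(1 + x²)`. -/
def jap (x : ℝ) : ℝ := √(1 + x ^ 2)

/-- The weighted norm `‖f‖_{L^{2,s}} = ‖⟨x⟩^s f‖_{L²}`, with values in `[0, ∞]`. -/
def weightedNorm (s : ℝ) (f : L2) : ℝ≥0∞ :=
  eLpNorm (fun x : ℝ => ((jap x ^ s : ℝ) : ℂ) * f x) 2 volume

/-- The Fourier transform of the pseudo-product `T_m(f, g)`:
`ξ ↦ ∫ m(ξ - η, η) f̂(ξ - η) ĝ(η) dη`. -/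
def pseudoProductHat (m : ℝ × ℝ → ℂ) (f g : L2) (ξ : ℝ) : ℂ :=
  ∫ η : ℝ, m (ξ - η, η) * hat f (ξ - η) * hat g η

/-- `y : [0, ∞) → L²(ℝ)` solves the Cauchy problem `i ∂ₜ y + p(D) y = F`, `y(t = 0) = h`, the
source being given by its Fourier transform `Fhat t ξ`. Since `p` is an arbitrary symbol, the
equation is read on the Fourier side, frequency by frequency: some version `Y t ξ` of
`ŷ(t, ξ)` satisfies `i ∂ₜ Y + p(ξ) Y = F̂(t, ξ)` for almost every `ξ` and all `t ≥ 0`. -/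
structure SolvesCauchy (p : ℝ → ℝ) (Fhat : ℝ → ℝ → ℂ) (h : L2) (y : ℝ → L2) : Prop where
  initial : y 0 = h
  equation : ∃ Y : ℝ → ℝ → ℂ,
    (∀ t : ℝ, 0 ≤ t → Y t =ᵐ[volume] hat (y t)) ∧
    ∀ᵐ ξ : ℝ, ∀ t : ℝ, 0 ≤ t →
      ∃ Y' : ℂ, HasDerivWithinAt (fun τ : ℝ => Y τ ξ) Y' (Set.Ici 0) t ∧
        I * Y' + (p ξ : ℂ) * Y t ξ = Fhat t ξ

/-- `(u, v, w)` solves the system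
`i ∂ₜ u + a(D) u = T_m(v, w)`, `i ∂ₜ v + b(D) v = 0`, `i ∂ₜ w + c(D) w = 0`
with data `u(0) = 0`, `v(0) = f`, `w(0) = g`. -/
structure IsSolution (a b c : ℝ → ℝ) (m : ℝ × ℝ → ℂ) (f g : L2) (u v w : ℝ → L2) : Prop where
  eq_u : SolvesCauchy a (fun t => pseudoProductHat m (v t) (w t)) 0 u
  eq_v : SolvesCauchy b (fun _ _ => 0) f v
  eq_w : SolvesCauchy c (fun _ _ => 0) g w

/-- The phase `φ(ξ, η) = -a(ξ + η) + b(ξ) + c(η)`. -/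
def phase (a b c : ℝ → ℝ) (p : ℝ × ℝ) : ℝ := -a (p.1 + p.2) + b p.1 + c p.2

/-- The time resonant set `Γ = {φ = 0}`. -/
def resonantSet (φ : ℝ × ℝ → ℝ) : Set (ℝ × ℝ) := {p | φ p = 0}

/-- `φ` vanishes (exactly) to first order on `Γ = {φ = 0}` at the points of `K`: the differential
of `φ` does not vanish there. By the implicit function theorem, `Γ` is then a smooth curve near
each of these points, with tangent line `ker dφ`. -/
def VanishesToFirstOrderOn (φ : ℝ × ℝ → ℝ) (K : Set (ℝ × ℝ)) : Prop :=
  ∀ p ∈ resonantSet φ ∩ K, fderiv ℝ φ p ≠ 0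

/-- The characteristic directions of the frequency plane `(ξ, η)`: those of the lines on which one
of the three frequencies `η`, `ξ`, `ξ + η` is constant. -/
def characteristicDirections : Set (ℝ × ℝ) := {(1, 0), (0, 1), (1, -1)}

/-- The curve `Γ = {φ = 0}` is non-characteristic at the points of `K`: its tangent line `ker dφ`
contains no characteristic direction. -/
def NonCharacteristicOn (φ : ℝ × ℝ → ℝ) (K : Set (ℝ × ℝ)) : Prop :=
  ∀ p ∈ resonantSet φ ∩ K, ∀ d ∈ characteristicDirections, d ∉ (fderiv ℝ φ p).ker

end

/-! Duhamel's formula removes the time variable: up to unimodular factors, the transform of `u t` is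
the bilinear integral of `hat f` and `hat g` with symbol `m · E(φ)`, where `E(y) = ∫₀ᵗ e^{iτy} dτ`
satisfies `|E(y)| ≤ min(t, 2/|y|)`. Cut dyadically in the size of `φ`: the piece of index `j` has a
kernel of size at most `4 min(1,t) 2^j`, supported in a strip `|φ| ≲ 2^{-j}`. The index stops at `J`
with `2^J ≤ max(1,t)`, since beyond that scale the bound `t` takes over.

Geometry enters only through the strips. Since `dφ` does not vanish on the three characteristic
directions at the zeros of `φ`, each strip meets every line of these directions in a set of length
`O(2^{-j})` (`exists_volume_slice_le`). Two bounds follow (`exists_bilinearHat_bounds`).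

In `L^∞`, Schur's test bounds the `L¹` norm of the transform of a piece by `2^j · 2^{-j} ‖f‖ ‖g‖`,
uniformly in `j`.

In `L²`, Cauchy–Schwarz along the lines `ξ + η = const` leaves the integral of `|f̂|² |ĝ|²` over the
strip. This gains another power of the width if `f̂` and `ĝ` are in `L⁴`. A function living where
`⟨x⟩ ~ 2^n` has a transform of `L⁴` norm at most about `2^{n(1/4-s)}` times its weighted norm. For
`s > 1/4` these bounds sum. For `s < 1/4` they are summed up to `⟨x⟩ ~ 2^j`, and the remainder is
small enough in `L²` to forgo the gain. The outcome is `2^{2κj}`, with `κ = 1/4 - s` or `κ = 0`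
respectively.

Interpolation gives `2^{4κj/q}` in `L^q`. The sum over `j ≤ J` is geometric when `κ > 0`, which
yields the power of `t`; it counts the pieces when `κ = 0`, or in `L^∞`, which yields the logarithm.
-/

noncomputable section

/-! ### The Fourier transform on `L²`: sup bounds, normalisation, inversion -/

/-- On `L¹ ∩ L²` the `L²` Fourier transform is bounded by the `L¹` norm. -/
theorem enorm_fourier_le_lintegral (f : L2) :
    ∀ᵐ ξ : ℝ, ‖(𝓕 f : L2) ξ‖ₑ ≤ ∫⁻ x, ‖f x‖ₑ := by
  by_cases hf : ∫⁻ x, ‖f x‖ₑ = ⊤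
  · simp [hf]
  have hint : Integrable (f : ℝ → ℂ) :=
    ⟨(Lp.stronglyMeasurable f).aestronglyMeasurable, by
      rw [hasFiniteIntegral_iff_enorm]; exact lt_top_iff_ne_top.2 hf⟩
  -- The `L²` transform is characterised by duality with Schwartz functions, and so is the Fourier
  -- integral by Fubini; testing against smooth compactly supported functions identifies the two.
  have key : ∀ᵐ ξ : ℝ, (𝓕 f : L2) ξ = 𝓕 (f : ℝ → ℂ) ξ := by
    apply ae_eq_of_integral_contDiff_smul_eq
    · exact (Lp.memLp (𝓕 f : L2)).locallyIntegrable (by norm_num)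
    · exact (VectorFourier.fourierIntegral_continuous Real.continuous_fourierChar
        (by exact continuous_inner) hint).locallyIntegrable
    · intro g hg hgc
      have hg₁ : HasCompactSupport (Complex.ofRealCLM ∘ g) := hgc.comp_left rfl
      have hg₂ : ContDiff ℝ ∞ (Complex.ofRealCLM ∘ g) := by fun_prop
      set G := hg₁.toSchwartzMap hg₂ with hG
      have h1 := congrArg (fun T => T G) (Lp.fourier_toTemperedDistribution_eq f)
      simp only [TemperedDistribution.fourier_apply, Lp.toTemperedDistribution_apply] at h1
      have h2 := VectorFourier.integral_fourierIntegral_smul_eq_flip (μ := volume) (ν := volume)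
        (L := innerₗ ℝ) Real.continuous_fourierChar (by exact continuous_inner)
        (f := (G : ℝ → ℂ)) (g := (f : ℝ → ℂ)) G.integrable hint
      have h3 : ∫ x, (𝓕 G) x • f x = ∫ x, G x • 𝓕 (f : ℝ → ℂ) x := by
        rw [flip_innerₗ] at h2
        exact h2
      rw [h3] at h1
      have h4 : ∀ x, G x = (g x : ℂ) := fun x => rfl
      simp only [h4, smul_eq_mul] at h1
      simpa [Complex.real_smul] using h1.symm
  filter_upwards [key] with ξ hξ
  rw [hξ]
  calc ‖𝓕 (f : ℝ → ℂ) ξ‖ₑ ≤ ENNReal.ofReal (∫ x, ‖f x‖) := by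
        rw [← ofReal_norm]
        exact ENNReal.ofReal_le_ofReal
          (VectorFourier.norm_fourierIntegral_le_integral_norm _ _ _ _ _)
    _ = _ := ofReal_integral_norm_eq_lintegral_enorm hint

/-- On `L¹ ∩ L²` the inverse `L²` Fourier transform is bounded by the `L¹` norm. -/
theorem enorm_fourierInv_le_lintegral (f : L2) :
    ∀ᵐ x : ℝ, ‖(𝓕⁻ f : L2) x‖ₑ ≤ ∫⁻ ξ, ‖f ξ‖ₑ := by
  by_cases hf : ∫⁻ x, ‖f x‖ₑ = ⊤
  · simp [hf]
  have hint : Integrable (f : ℝ → ℂ) :=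
    ⟨(Lp.stronglyMeasurable f).aestronglyMeasurable, by
      rw [hasFiniteIntegral_iff_enorm]; exact lt_top_iff_ne_top.2 hf⟩
  have key : ∀ᵐ ξ : ℝ, (𝓕⁻ f : L2) ξ = 𝓕⁻ (f : ℝ → ℂ) ξ := by
    apply ae_eq_of_integral_contDiff_smul_eq
    · exact (Lp.memLp (𝓕⁻ f : L2)).locallyIntegrable (by norm_num)
    · exact (VectorFourier.fourierIntegral_continuous (L := -innerₗ ℝ)
        Real.continuous_fourierChar (by exact continuous_inner.neg) hint).locallyIntegrable
    · intro g hg hgc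
      have hg₁ : HasCompactSupport (Complex.ofRealCLM ∘ g) := hgc.comp_left rfl
      have hg₂ : ContDiff ℝ ∞ (Complex.ofRealCLM ∘ g) := by fun_prop
      set G := hg₁.toSchwartzMap hg₂ with hG
      have h1 := congrArg (fun T => T G) (Lp.fourierInv_toTemperedDistribution_eq f)
      simp only [TemperedDistribution.fourierInv_apply, Lp.toTemperedDistribution_apply] at h1
      have h2 := VectorFourier.integral_fourierIntegral_smul_eq_flip (μ := volume) (ν := volume)
        (L := -innerₗ ℝ) Real.continuous_fourierChar (by exact continuous_inner.neg)
        (f := (G : ℝ → ℂ)) (g := (f : ℝ → ℂ)) G.integrable hint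
      have h3 : ∫ x, (𝓕⁻ G) x • f x = ∫ x, G x • 𝓕⁻ (f : ℝ → ℂ) x := by
        have h5 : (-innerₗ ℝ : ℝ →ₗ[ℝ] ℝ →ₗ[ℝ] ℝ).flip = -innerₗ ℝ := by
          ext; simp
        rw [h5] at h2
        rw [SchwartzMap.fourierInv_coe]
        exact h2
      rw [h3] at h1
      have h4 : ∀ x, G x = (g x : ℂ) := fun x => rfl
      simp only [h4, smul_eq_mul] at h1
      simpa [Complex.real_smul] using h1.symm
  filter_upwards [key] with ξ hξ
  rw [hξ]
  calc ‖𝓕⁻ (f : ℝ → ℂ) ξ‖ₑ ≤ ENNReal.ofReal (∫ x, ‖f x‖) := by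
        rw [← ofReal_norm]
        exact ENNReal.ofReal_le_ofReal
          (VectorFourier.norm_fourierIntegral_le_integral_norm _ _ _ _ _)
    _ = _ := ofReal_integral_norm_eq_lintegral_enorm hint

theorem quasiMeasurePreserving_mul_const {r : ℝ} (hr : r ≠ 0) :
    Measure.QuasiMeasurePreserving (fun x : ℝ => x * r) volume volume := by
  refine ⟨by fun_prop, ?_⟩
  rw [Real.map_volume_mul_right hr]
  exact Measure.smul_absolutelyContinuous

theorem eLpNorm_comp_mul_const {r : ℝ} (hr : r ≠ 0) {f : ℝ → ℂ} (hf : AEStronglyMeasurable f)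
    (p : ℝ≥0∞) (hp : p ≠ ⊤) :
    eLpNorm (fun x => f (x * r)) p volume
      = ENNReal.ofReal |r⁻¹| ^ (1 / p).toReal * eLpNorm f p volume := by
  have h := eLpNorm_map_measure (p := p) (μ := volume) (f := fun x : ℝ => x * r) (g := f)
    (by rw [Real.map_volume_mul_right hr]; exact hf.smul_measure _) (by fun_prop)
  rw [Real.map_volume_mul_right hr, eLpNorm_smul_measure_of_ne_top hp] at h
  simpa [Function.comp_def] using h.symm

theorem measurable_hat (f : L2) : Measurable (hat f) := by
  have := (Lp.stronglyMeasurable (𝓕 f : L2)).measurable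
  unfold hat
  fun_prop

theorem hat_congr_comp (f : L2) {h : ℝ → ℂ} (hh : (𝓕 f : L2) =ᵐ[volume] h) :
    hat f =ᵐ[volume] fun ξ => ((√(2 * Real.pi))⁻¹ : ℝ) * h (ξ * (2 * Real.pi)⁻¹) := by
  have hr : (2 * Real.pi)⁻¹ ≠ 0 := by positivity
  filter_upwards [(quasiMeasurePreserving_mul_const hr).ae_eq_comp hh] with ξ hξ
  simp only [Function.comp] at hξ
  rw [hat, div_eq_mul_inv, hξ]

theorem hat_zero : hat 0 =ᵐ[volume] 0 := by
  have h : 𝓕 (0 : L2) = 0 := (Lp.fourierTransformₗᵢ ℝ ℂ).map_zero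
  have := hat_congr_comp (0 : L2) (h := 0) (by rw [h]; exact Lp.coeFn_zero _ _ _)
  filter_upwards [this] with ξ hξ
  simp [hξ]

theorem hat_add (f g : L2) : hat (f + g) =ᵐ[volume] hat f + hat g := by
  have h : 𝓕 (f + g) = 𝓕 f + 𝓕 g := (Lp.fourierTransformₗᵢ ℝ ℂ).map_add f g
  have := hat_congr_comp (f + g) (h := fun x => (𝓕 f : L2) x + (𝓕 g : L2) x)
    (by rw [h]; exact Lp.coeFn_add _ _)
  filter_upwards [this] with ξ hξ
  rw [hξ, Pi.add_apply, hat, hat, div_eq_mul_inv]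
  ring

theorem hat_sum {ι : Type*} (s : Finset ι) (f : ι → L2) :
    hat (∑ i ∈ s, f i) =ᵐ[volume] fun ξ => ∑ i ∈ s, hat (f i) ξ := by
  classical
  induction s using Finset.induction_on with
  | empty => simpa using! hat_zero
  | insert i s hi ih =>
    rw [Finset.sum_insert hi]
    filter_upwards [hat_add (f i) (∑ i ∈ s, f i), ih] with ξ h1 h2
    rw [h1, Finset.sum_insert hi, Pi.add_apply, h2]

theorem eLpNorm_hat (f : L2) : eLpNorm (hat f) 2 volume = eLpNorm f 2 volume := by
  have hr : (2 * Real.pi)⁻¹ ≠ 0 := by positivity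
  have hpi := Real.pi_pos
  have h1 : hat f = (((√(2 * Real.pi))⁻¹ : ℝ) : ℂ) •
      fun ξ => (𝓕 f : L2) (ξ * (2 * Real.pi)⁻¹) := by
    ext ξ; simp [hat, div_eq_mul_inv]
  rw [h1, eLpNorm_const_smul, eLpNorm_comp_mul_const hr
    (Lp.stronglyMeasurable _).aestronglyMeasurable 2 (by norm_num), ← mul_assoc]
  have h2 : eLpNorm (𝓕 f : L2) 2 volume = eLpNorm f 2 volume := by
    have h := Lp.norm_fourier_eq f
    rw [Lp.norm_def, Lp.norm_def, ENNReal.toReal_eq_toReal_iff' (Lp.eLpNorm_ne_top _)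
      (Lp.eLpNorm_ne_top _)] at h
    exact h
  rw [h2]
  have h3 : ‖(((√(2 * Real.pi))⁻¹ : ℝ) : ℂ)‖ₑ * ENNReal.ofReal |(2 * Real.pi)⁻¹⁻¹| ^
      (1 / (2 : ℝ≥0∞)).toReal = 1 := by
    rw [inv_inv, abs_of_pos (by positivity), ENNReal.ofReal_rpow_of_nonneg (by positivity)
      (by positivity), ← ofReal_norm, ← ENNReal.ofReal_mul (by positivity),
      Complex.norm_real, Real.norm_of_nonneg (by positivity)]
    have : (1 / (2 : ℝ≥0∞)).toReal = 1 / 2 := by simp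
    rw [this, ← Real.sqrt_eq_rpow, inv_mul_cancel₀ (by positivity), ENNReal.ofReal_one]
  rw [h3, one_mul]

theorem hat_injective {f g : L2} (h : hat f =ᵐ[volume] hat g) : f = g := by
  have h1 : hat (f - g) =ᵐ[volume] 0 := by
    have h2 := hat_add (f - g) g
    rw [sub_add_cancel] at h2
    filter_upwards [h, h2] with ξ h3 h4
    rw [h3, Pi.add_apply] at h4
    simpa using h4.symm
  have h2 := eLpNorm_hat (f - g)
  rw [eLpNorm_congr_ae h1, eLpNorm_zero] at h2
  have h3 : ‖f - g‖ = 0 := by rw [Lp.norm_def, ← h2]; simp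
  exact sub_eq_zero.1 (norm_eq_zero.1 h3)

/-- The transform of `f` is bounded by the `L¹` norm of `f`. -/
theorem enorm_hat_le_lintegral (f : L2) : ∀ᵐ ξ : ℝ, ‖hat f ξ‖ₑ ≤ ∫⁻ x, ‖f x‖ₑ := by
  have hr : (2 * Real.pi)⁻¹ ≠ 0 := by positivity
  filter_upwards [(quasiMeasurePreserving_mul_const hr).ae (enorm_fourier_le_lintegral f)] with ξ h
  rw [hat, enorm_mul, div_eq_mul_inv]
  refine (mul_le_mul' ?_ h).trans_eq (one_mul _)
  rw [← ofReal_norm, Complex.norm_real, Real.norm_of_nonneg (by positivity)]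
  refine ENNReal.ofReal_le_one.2 (inv_le_one_of_one_le₀ ?_)
  rw [Real.one_le_sqrt]
  linarith [Real.pi_gt_three]

/-- Every `U ∈ L²` is the transform of some `y ∈ L²`, whose sup norm is bounded by `‖U‖_{L¹}`. -/
theorem exists_hat_eq {U : ℝ → ℂ} (hU : MemLp U 2 volume) :
    ∃ y : L2, hat y =ᵐ[volume] U ∧ eLpNorm y ⊤ volume ≤ ∫⁻ ξ, ‖U ξ‖ₑ := by
  have hpi := Real.pi_pos
  have hr : 2 * Real.pi ≠ 0 := by positivity
  set V : ℝ → ℂ := fun x => (√(2 * Real.pi) : ℂ) * U (x * (2 * Real.pi)) with hV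
  have hVL : MemLp V 2 volume := by
    refine MemLp.const_mul ⟨?_, ?_⟩ _
    · exact hU.1.comp_quasiMeasurePreserving (quasiMeasurePreserving_mul_const hr)
    · rw [eLpNorm_comp_mul_const hr hU.1 2 (by norm_num)]
      exact ENNReal.mul_lt_top (ENNReal.rpow_lt_top_of_nonneg (by simp) ENNReal.ofReal_ne_top) hU.2
  refine ⟨𝓕⁻ hVL.toLp, ?_, ?_⟩
  · have h := hat_congr_comp (𝓕⁻ hVL.toLp) (h := V)
      (by rw [FourierTransform.fourier_fourierInv_eq]; exact hVL.coeFn_toLp)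
    filter_upwards [h] with ξ hξ
    rw [hξ]
    simp only [hV]
    have h0 : √(2 * Real.pi) ≠ 0 := by positivity
    have h0' : (√(2 * Real.pi) : ℂ) ≠ 0 := by exact_mod_cast h0
    rw [mul_assoc ξ, inv_mul_cancel₀ hr, mul_one, Complex.ofReal_inv, ← mul_assoc,
      inv_mul_cancel₀ h0', one_mul]
  · have h1 := enorm_fourierInv_le_lintegral hVL.toLp
    have h2 : ∫⁻ ξ, ‖(hVL.toLp : L2) ξ‖ₑ = ∫⁻ ξ, ‖V ξ‖ₑ :=
      by
      refine lintegral_congr_ae ?_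
      filter_upwards [hVL.coeFn_toLp] with ξ h
      rw [h]
    have h3 : ∫⁻ ξ, ‖V ξ‖ₑ ≤ ∫⁻ ξ, ‖U ξ‖ₑ := by
      have h4 := eLpNorm_comp_mul_const hr hU.1 1 (by norm_num)
      simp only [eLpNorm_one_eq_lintegral_enorm] at h4
      simp only [hV, enorm_mul]
      rw [lintegral_const_mul' _ _ enorm_ne_top, h4, ← mul_assoc]
      refine (mul_le_mul' ?_ le_rfl).trans_eq (one_mul _)
      rw [← ofReal_norm, Complex.norm_real, Real.norm_of_nonneg (by positivity),
        abs_of_pos (by positivity)]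
      simp only [div_one, ENNReal.toReal_one, ENNReal.rpow_one]
      rw [← ENNReal.ofReal_mul (by positivity)]
      refine ENNReal.ofReal_le_one.2 ?_
      -- The dilation contributes `(2π)⁻¹` and the prefactor `√(2π)`; their product is below 1.
      rw [← div_eq_mul_inv, div_le_one (by positivity), Real.sqrt_le_left (by positivity)]
      nlinarith [Real.pi_gt_three]
    rw [eLpNorm_exponent_top]
    refine (essSup_le_of_ae_le _ h1).trans ?_
    rw [h2]
    exact h3

/-! ### Slices of the strip around the resonant curve -/

/-- If `dφ(d) ≠ 0` at the zeros of `φ` in the compact set `K`, the part of `K ∩ {|φ| ≤ δ}` on any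
line of direction `d` has length `O(δ)`. -/
theorem exists_volume_slice_le {φ : ℝ × ℝ → ℝ} (hφ : ContDiff ℝ 1 φ) {K : Set (ℝ × ℝ)}
    (hK : IsCompact K) {d : ℝ × ℝ} (hd : d ≠ 0) (h : ∀ p ∈ K, φ p = 0 → fderiv ℝ φ p d ≠ 0) :
    ∃ C : ℝ, 0 ≤ C ∧ ∀ (p : ℝ × ℝ) (δ : ℝ), 0 < δ →
      volume {τ : ℝ | p + τ • d ∈ K ∧ |φ (p + τ • d)| ≤ δ} ≤ ENNReal.ofReal (C * δ) := by
  have hdn : 0 < ‖d‖ := norm_pos_iff.2 hd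
  have vol_le : ∀ (s : Set ℝ) (r : ℝ), (∀ x ∈ s, ∀ y ∈ s, x < y → y - x ≤ r) → 0 ≤ r →
      volume s ≤ ENNReal.ofReal r := by
    intro s r hs hr
    refine (Real.volume_le_diam s).trans (Metric.ediam_le ?_)
    intro x hx y hy
    rw [edist_dist, Real.dist_eq]
    apply ENNReal.ofReal_le_ofReal
    rcases lt_trichotomy x y with hxy | hxy | hxy
    · rw [abs_sub_comm, abs_of_pos (by linarith)]; exact hs x hx y hy hxy
    · simpa [hxy] using hr
    · rw [abs_of_pos (by linarith)]; exact hs y hy x hx hxy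
  -- The claim passes to subsets and finite unions, so by compactness it suffices to prove it near
  -- each point of `K`.
  refine hK.induction_on (p := fun S => ∃ C : ℝ, 0 ≤ C ∧ ∀ (p : ℝ × ℝ) (δ : ℝ), 0 < δ →
      volume {τ : ℝ | p + τ • d ∈ S ∧ |φ (p + τ • d)| ≤ δ} ≤ ENNReal.ofReal (C * δ)) ?_ ?_ ?_ ?_
  · exact ⟨0, le_rfl, by simp⟩
  · rintro s t hst ⟨C, hC, H⟩
    refine ⟨C, hC, fun p δ hδ => (measure_mono ?_).trans (H p δ hδ)⟩
    exact fun τ hτ => ⟨hst hτ.1, hτ.2⟩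
  · rintro s t ⟨C, hC, H⟩ ⟨C', hC', H'⟩
    refine ⟨C + C', by positivity, fun p δ hδ => ?_⟩
    rw [add_mul, ENNReal.ofReal_add (by positivity) (by positivity)]
    refine (measure_mono ?_).trans ((measure_union_le _ _).trans
      (add_le_add (H p δ hδ) (H' p δ hδ)))
    rintro τ ⟨h1 | h1, h2⟩
    · exact Or.inl ⟨h1, h2⟩
    · exact Or.inr ⟨h1, h2⟩
  · intro x hx
    by_cases hx0 : φ x = 0
    · have hL := h x hx hx0
      set L := fderiv ℝ φ x d with hLdef
      have hcont : Continuous fun y => |fderiv ℝ φ y d| :=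
        ((hφ.continuous_fderiv one_ne_zero).clm_apply continuous_const).abs
      have hev : ∀ᶠ y in nhds x, |L| / 2 < |fderiv ℝ φ y d| :=
        hcont.continuousAt.eventually (lt_mem_nhds (by
          have := abs_pos.2 hL
          show |L| / 2 < |L|
          linarith))
      obtain ⟨r, hr, hball⟩ := Metric.eventually_nhds_iff_ball.1 hev
      have hLp : 0 < |L| := abs_pos.2 hL
      refine ⟨Metric.ball x r, mem_nhdsWithin_of_mem_nhds (Metric.ball_mem_nhds x hr),
        4 / |L|, by positivity, fun p δ hδ => vol_le _ _ ?_ (by positivity)⟩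
      rintro τ₁ ⟨h1, h1'⟩ τ₂ ⟨h2, h2'⟩ hlt
      have hder : ∀ τ : ℝ, HasDerivAt (fun τ : ℝ => φ (p + τ • d))
          (fderiv ℝ φ (p + τ • d) d) τ := by
        intro τ
        have h3 : HasDerivAt (fun τ : ℝ => p + τ • d) d τ := by
          simpa using ((hasDerivAt_id τ).smul_const d).const_add p
        exact ((hφ.differentiable one_ne_zero _).hasFDerivAt).comp_hasDerivAt τ h3
      obtain ⟨z, hz, hz'⟩ := exists_hasDerivAt_eq_slope (fun τ : ℝ => φ (p + τ • d)) _ hlt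
        (fun τ _ => (hder τ).continuousAt.continuousWithinAt) (fun τ _ => hder τ)
      have hzb : p + z • d ∈ Metric.ball x r := by
        have hseg : segment ℝ (p + τ₁ • d) (p + τ₂ • d) ⊆ Metric.ball x r :=
          (convex_ball x r).segment_subset h1 h2
        apply hseg
        have hpos : 0 < τ₂ - τ₁ := by linarith
        refine ⟨(τ₂ - z) / (τ₂ - τ₁), (z - τ₁) / (τ₂ - τ₁), ?_, ?_, ?_, ?_⟩
        · exact div_nonneg (by linarith [hz.2]) hpos.le
        · exact div_nonneg (by linarith [hz.1]) hpos.le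
        · field_simp; ring
        · ext <;> simp <;> field_simp <;> ring
      have hb := hball _ hzb
      rw [hz', abs_div, abs_of_pos (by linarith : 0 < τ₂ - τ₁),
        lt_div_iff₀ (by linarith)] at hb
      have h5 : |φ (p + τ₂ • d) - φ (p + τ₁ • d)| ≤ 2 * δ := by
        refine (abs_sub _ _).trans ?_
        linarith
      rw [div_mul_eq_mul_div, le_div_iff₀ hLp]
      linarith
    · have he : 0 < |φ x| / 2 := by have := abs_pos.2 hx0; positivity
      have hev : ∀ᶠ y in nhds x, |φ x| / 2 < |φ y| :=
        hφ.continuous.abs.continuousAt.eventually (lt_mem_nhds (by linarith))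
      obtain ⟨r, hr, hball⟩ := Metric.eventually_nhds_iff_ball.1 hev
      refine ⟨Metric.ball x r, mem_nhdsWithin_of_mem_nhds (Metric.ball_mem_nhds x hr),
        2 * r / ‖d‖ / (|φ x| / 2), by positivity, fun p δ hδ => ?_⟩
      refine vol_le _ _ ?_ (by positivity)
      rintro τ₁ ⟨h1, h1'⟩ τ₂ ⟨h2, h2'⟩ hlt
      have h3 : dist (p + τ₂ • d) (p + τ₁ • d) ≤ 2 * r := by
        have := dist_triangle_right (p + τ₂ • d) (p + τ₁ • d) x
        have h1 := Metric.mem_ball.1 h1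
        have h2 := Metric.mem_ball.1 h2
        linarith
      have h4 : dist (p + τ₂ • d) (p + τ₁ • d) = (τ₂ - τ₁) * ‖d‖ := by
        rw [dist_add_left, dist_eq_norm, ← sub_smul, norm_smul, Real.norm_of_nonneg (by linarith)]
      have h5 : |φ x| / 2 ≤ δ := ((hball _ h1).trans_le h1').le
      have h6 : τ₂ - τ₁ ≤ 2 * r / ‖d‖ := by
        rw [le_div_iff₀ hdn, ← h4]; exact h3
      refine h6.trans ?_
      rw [div_mul_eq_mul_div, le_div_iff₀ he]
      exact mul_le_mul_of_nonneg_left h5 (by positivity)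

/-! ### Bilinear estimates on a planar set with short slices -/

/-- The Cauchy–Schwarz inequality for a nonnegative weight. -/
theorem sq_lintegral_mul_le {α : Type*} [MeasurableSpace α] {μ : Measure α} {f h : α → ℝ≥0∞}
    (hf : AEMeasurable f μ) (hh : AEMeasurable h μ) :
    (∫⁻ x, f x * h x ∂μ) ^ 2 ≤ (∫⁻ x, h x ∂μ) * ∫⁻ x, f x ^ 2 * h x ∂μ := by
  have h1 := ENNReal.lintegral_mul_le_Lp_mul_Lq μ (p := 2) (q := 2)
    (by rw [Real.holderConjugate_iff]; norm_num)
    (f := fun x => f x * h x ^ (1 / 2 : ℝ)) (g := fun x => h x ^ (1 / 2 : ℝ))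
    (hf.mul (hh.pow_const _)) (hh.pow_const _)
  have hsq : ∀ x : ℝ≥0∞, x ^ (1 / 2 : ℝ) * x ^ (1 / 2 : ℝ) = x := by
    intro x
    rw [← ENNReal.rpow_add_of_nonneg _ _ (by norm_num) (by norm_num)]
    norm_num
  have hsq' : ∀ x : ℝ≥0∞, (x ^ (1 / 2 : ℝ)) ^ (2 : ℝ) = x := by
    intro x
    rw [← ENNReal.rpow_mul]; norm_num
  simp only [Pi.mul_apply, mul_assoc, hsq] at h1
  simp only [ENNReal.mul_rpow_of_nonneg _ _ (zero_le_two : (0 : ℝ) ≤ 2), hsq',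
    ENNReal.rpow_two] at h1
  calc _ ≤ _ := pow_le_pow_left' h1 2
    _ = _ := by
      rw [mul_pow, ← ENNReal.rpow_two, ← ENNReal.rpow_two, hsq', hsq', mul_comm]

/-- The Cauchy–Schwarz inequality. -/
theorem sq_lintegral_mul_le_mul {α : Type*} [MeasurableSpace α] {μ : Measure α}
    {f g : α → ℝ≥0∞} (hf : AEMeasurable f μ) (hg : AEMeasurable g μ) :
    (∫⁻ x, f x * g x ∂μ) ^ 2 ≤ (∫⁻ x, f x ^ 2 ∂μ) * ∫⁻ x, g x ^ 2 ∂μ := by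
  have h1 := ENNReal.lintegral_mul_le_Lp_mul_Lq μ (p := 2) (q := 2)
    (by rw [Real.holderConjugate_iff]; norm_num) hf hg
  simp only [ENNReal.rpow_two] at h1
  have hsq' : ∀ x : ℝ≥0∞, (x ^ (1 / 2 : ℝ)) ^ 2 = x := by
    intro x
    rw [← ENNReal.rpow_two, ← ENNReal.rpow_mul]; norm_num
  calc _ ≤ _ := pow_le_pow_left' h1 2
    _ = _ := by rw [mul_pow, hsq', hsq']

section SchurTest

variable {S : Set (ℝ × ℝ)} {σ : ℝ≥0∞}

theorem setLIntegral_fst_le (hS : MeasurableSet S)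
    (hx : ∀ x : ℝ, volume {y : ℝ | (x, y) ∈ S} ≤ σ) {h : ℝ → ℝ≥0∞} (hh : Measurable h) :
    ∫⁻ p in S, h p.1 ≤ σ * ∫⁻ x, h x := by
  rw [← lintegral_indicator hS, Measure.volume_eq_prod, lintegral_prod _
    ((by fun_prop : Measurable fun p : ℝ × ℝ => h p.1).indicator hS).aemeasurable, ← lintegral_const_mul _ hh]
  refine lintegral_mono fun x => ?_
  have : ∀ y, S.indicator (fun p : ℝ × ℝ => h p.1) (x, y)
      = {y : ℝ | (x, y) ∈ S}.indicator (fun _ => h x) y := by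
    intro y; by_cases hy : (x, y) ∈ S <;> simp [hy]
  simp only [this]
  rw [lintegral_indicator_const (show MeasurableSet {y : ℝ | (x, y) ∈ S} from measurable_prodMk_left hS),
    mul_comm]
  exact mul_le_mul' (hx x) le_rfl

theorem setLIntegral_snd_le (hS : MeasurableSet S)
    (hy : ∀ y : ℝ, volume {x : ℝ | (x, y) ∈ S} ≤ σ) {h : ℝ → ℝ≥0∞} (hh : Measurable h) :
    ∫⁻ p in S, h p.2 ≤ σ * ∫⁻ y, h y := by
  rw [← lintegral_indicator hS, Measure.volume_eq_prod, lintegral_prod_symm _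
    ((by fun_prop : Measurable fun p : ℝ × ℝ => h p.2).indicator hS).aemeasurable, ← lintegral_const_mul _ hh]
  refine lintegral_mono fun y => ?_
  have : ∀ x, S.indicator (fun p : ℝ × ℝ => h p.2) (x, y)
      = {x : ℝ | (x, y) ∈ S}.indicator (fun _ => h y) x := by
    intro x; by_cases hy : (x, y) ∈ S <;> simp [hy]
  simp only [this]
  rw [lintegral_indicator_const (show MeasurableSet {x : ℝ | (x, y) ∈ S} from measurable_prodMk_right hS),
    mul_comm]
  exact mul_le_mul' (hy y) le_rfl

/-- Schur's test. -/
theorem sq_setLIntegral_prod_le (hS : MeasurableSet S)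
    (hx : ∀ x : ℝ, volume {y : ℝ | (x, y) ∈ S} ≤ σ)
    (hy : ∀ y : ℝ, volume {x : ℝ | (x, y) ∈ S} ≤ σ) {F G : ℝ → ℝ≥0∞}
    (hF : Measurable F) (hG : Measurable G) :
    (∫⁻ p in S, F p.1 * G p.2) ^ 2 ≤ σ ^ 2 * (∫⁻ x, F x ^ 2) * ∫⁻ y, G y ^ 2 := by
  refine (sq_lintegral_mul_le_mul (by fun_prop) (by fun_prop)).trans ?_
  refine (mul_le_mul' (setLIntegral_fst_le hS hx (hF.pow_const 2))
    (setLIntegral_snd_le hS hy (hG.pow_const 2))).trans_eq ?_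
  ring

theorem setLIntegral_prod_le_mul {F G : ℝ → ℝ≥0∞} (hF : Measurable F) (hG : Measurable G) :
    ∫⁻ p in S, F p.1 * G p.2 ≤ (∫⁻ x, F x) * ∫⁻ y, G y := by
  refine (setLIntegral_le_lintegral _ _).trans_eq ?_
  rw [Measure.volume_eq_prod, lintegral_prod_mul hF.aemeasurable hG.aemeasurable]

/-- Cauchy–Schwarz with `G` as the weight. Only one of the two resulting factors uses the slices, so
an `L²` function against an `L¹` function gains half of the power of `σ` that Schur's test gives. -/
theorem sq_setLIntegral_prod_le_left (hS : MeasurableSet S)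
    (hy : ∀ y : ℝ, volume {x : ℝ | (x, y) ∈ S} ≤ σ) {F G : ℝ → ℝ≥0∞}
    (hF : Measurable F) (hG : Measurable G) :
    (∫⁻ p in S, F p.1 * G p.2) ^ 2 ≤ σ * (∫⁻ x, F x ^ 2) * (∫⁻ y, G y) ^ 2 := by
  refine (sq_lintegral_mul_le (f := fun p : ℝ × ℝ => F p.1) (h := fun p : ℝ × ℝ => G p.2)
    (by fun_prop) (by fun_prop)).trans ?_
  refine (mul_le_mul' (setLIntegral_snd_le hS hy hG)
    (setLIntegral_prod_le_mul (hF.pow_const 2) hG)).trans_eq ?_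
  ring

theorem sq_setLIntegral_prod_le_right (hS : MeasurableSet S)
    (hx : ∀ x : ℝ, volume {y : ℝ | (x, y) ∈ S} ≤ σ) {F G : ℝ → ℝ≥0∞}
    (hF : Measurable F) (hG : Measurable G) :
    (∫⁻ p in S, F p.1 * G p.2) ^ 2 ≤ σ * (∫⁻ x, F x) ^ 2 * (∫⁻ y, G y ^ 2) := by
  simp only [fun p : ℝ × ℝ => mul_comm (F p.1) (G p.2)]
  refine (sq_lintegral_mul_le (f := fun p : ℝ × ℝ => G p.2) (h := fun p : ℝ × ℝ => F p.1)
    (by fun_prop) (by fun_prop)).trans ?_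
  simp only [fun p : ℝ × ℝ => mul_comm (G p.2 ^ 2) (F p.1)]
  refine (mul_le_mul' (setLIntegral_fst_le hS hx hF)
    (setLIntegral_prod_le_mul hF (hG.pow_const 2))).trans_eq ?_
  ring

theorem lintegral_lintegral_sub_eq {h : ℝ × ℝ → ℝ≥0∞} (hh : Measurable h) :
    ∫⁻ ξ : ℝ, ∫⁻ η : ℝ, h (ξ - η, η) = ∫⁻ p, h p := by
  rw [lintegral_lintegral_swap (by fun_prop), Measure.volume_eq_prod,
    lintegral_prod_symm _ hh.aemeasurable]
  refine lintegral_congr fun η => ?_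
  exact lintegral_sub_right_eq_self (fun ξ => h (ξ, η)) η

theorem lintegral_convolution_eq (hS : MeasurableSet S) {F G : ℝ → ℝ≥0∞}
    (hF : Measurable F) (hG : Measurable G) :
    ∫⁻ ξ : ℝ, ∫⁻ η in {η | (ξ - η, η) ∈ S}, F (ξ - η) * G η = ∫⁻ p in S, F p.1 * G p.2 := by
  have hm : Measurable fun p : ℝ × ℝ => F p.1 * G p.2 := by fun_prop
  rw [← lintegral_indicator hS, ← lintegral_lintegral_sub_eq (hm.indicator hS)]
  refine lintegral_congr fun ξ => ?_
  rw [← lintegral_indicator]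
  · rfl
  · exact (by fun_prop : Measurable fun η : ℝ => (ξ - η, η)) hS

/-- Cauchy–Schwarz against the constant 1 on each line `ξ + η = const`, whose slice has length at
most `σ`; integrating in `ξ` recovers the planar integral. -/
theorem lintegral_sq_convolution_le (hS : MeasurableSet S)
    (hd : ∀ ξ : ℝ, volume {η : ℝ | (ξ - η, η) ∈ S} ≤ σ) {F G : ℝ → ℝ≥0∞}
    (hF : Measurable F) (hG : Measurable G) :
    ∫⁻ ξ : ℝ, (∫⁻ η in {η | (ξ - η, η) ∈ S}, F (ξ - η) * G η) ^ 2
      ≤ σ * ∫⁻ p in S, F p.1 ^ 2 * G p.2 ^ 2 := by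
  have hm : Measurable fun p : ℝ × ℝ => F p.1 ^ 2 * G p.2 ^ 2 := by fun_prop
  rw [← lintegral_convolution_eq hS (hF.pow_const 2) (hG.pow_const 2)]
  have hms : Measurable fun ξ : ℝ =>
      ∫⁻ η in {η | (ξ - η, η) ∈ S}, F (ξ - η) ^ 2 * G η ^ 2 := by
    have h1 : ∀ ξ : ℝ, ∫⁻ η in {η | (ξ - η, η) ∈ S}, F (ξ - η) ^ 2 * G η ^ 2
        = ∫⁻ η, S.indicator (fun p : ℝ × ℝ => F p.1 ^ 2 * G p.2 ^ 2) (ξ - η, η) := by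
      intro ξ
      rw [← lintegral_indicator]
      · rfl
      · exact (by fun_prop : Measurable fun η : ℝ => (ξ - η, η)) hS
    simp only [h1]
    have h2 : Measurable fun q : ℝ × ℝ =>
        S.indicator (fun p : ℝ × ℝ => F p.1 ^ 2 * G p.2 ^ 2) (q.1 - q.2, q.2) :=
      (hm.indicator hS).comp (by fun_prop)
    exact h2.lintegral_prod_right'
  rw [← lintegral_const_mul _ hms]
  refine lintegral_mono fun ξ => ?_
  have h1 := sq_lintegral_mul_le_mul (μ := volume.restrict {η | (ξ - η, η) ∈ S})
    (f := fun _ => 1) (g := fun η => F (ξ - η) * G η) (by fun_prop) (by fun_prop)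
  simp only [one_mul, one_pow, lintegral_one, Measure.restrict_apply_univ, mul_pow] at h1
  exact h1.trans (mul_le_mul' (hd ξ) le_rfl)

/-- The `L²` estimate of a bilinear operator whose kernel is the indicator function of a strip of
width `ρ²`, for functions that split into an `L⁴` and an `L²` part. -/
theorem lintegral_sq_convolution_le_of_split {ρ : ℝ≥0∞} (hS : MeasurableSet S)
    (hx : ∀ x : ℝ, volume {y : ℝ | (x, y) ∈ S} ≤ ρ ^ 2)
    (hy : ∀ y : ℝ, volume {x : ℝ | (x, y) ∈ S} ≤ ρ ^ 2)
    (hd : ∀ ξ : ℝ, volume {η : ℝ | (ξ - η, η) ∈ S} ≤ ρ ^ 2)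
    {F G A B A' B' : ℝ → ℝ≥0∞} (hF : Measurable F) (hG : Measurable G)
    (hA : Measurable A) (hB : Measurable B) (hA' : Measurable A') (hB' : Measurable B')
    (hFAB : ∀ᵐ x : ℝ, F x ^ 2 ≤ A x + B x) (hGAB : ∀ᵐ x : ℝ, G x ^ 2 ≤ A' x + B' x)
    {α β W W' : ℝ≥0∞} (hαA : ∫⁻ x, A x ^ 2 ≤ (α * W) ^ 2) (hβB : ∫⁻ x, B x ≤ β * W)
    (hαA' : ∫⁻ x, A' x ^ 2 ≤ (α * W') ^ 2) (hβB' : ∫⁻ x, B' x ≤ β * W') :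
    ∫⁻ ξ : ℝ, (∫⁻ η in {η | (ξ - η, η) ∈ S}, F (ξ - η) * G η) ^ 2
      ≤ ρ ^ 2 * (ρ * α + β) ^ 2 * (W * W') := by
  have hsq : ∀ {x y : ℝ≥0∞}, x ^ 2 ≤ y ^ 2 → x ≤ y := fun {x y} h =>
    (ENNReal.pow_right_strictMono two_ne_zero).le_iff_le.1 h
  refine (lintegral_sq_convolution_le hS hd hF hG).trans ?_
  rw [mul_assoc]
  refine mul_le_mul' le_rfl ?_
  have h1 : ∫⁻ p in S, F p.1 ^ 2 * G p.2 ^ 2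
      ≤ ∫⁻ p in S, (A p.1 * A' p.2 + A p.1 * B' p.2) + (B p.1 * A' p.2 + B p.1 * B' p.2) := by
    refine lintegral_mono_ae (ae_restrict_of_ae ?_)
    have e1 : ∀ᵐ p : ℝ × ℝ, F p.1 ^ 2 ≤ A p.1 + B p.1 :=
      Measure.quasiMeasurePreserving_fst.ae hFAB
    have e2 : ∀ᵐ p : ℝ × ℝ, G p.2 ^ 2 ≤ A' p.2 + B' p.2 :=
      Measure.quasiMeasurePreserving_snd.ae hGAB
    filter_upwards [e1, e2] with p h1 h2
    exact (mul_le_mul' h1 h2).trans_eq (by ring)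
  refine h1.trans ?_
  rw [lintegral_add_left (by fun_prop), lintegral_add_left (by fun_prop),
    lintegral_add_left (by fun_prop)]
  -- Each `L²` factor gains one power of `ρ` and each `L¹` factor gains none, so the four products
  -- add up to a perfect square.
  have hAA : ∫⁻ p in S, A p.1 * A' p.2 ≤ ρ ^ 2 * (α * W) * (α * W') := by
    apply hsq
    refine (sq_setLIntegral_prod_le hS hx hy hA hA').trans ?_
    rw [mul_pow, mul_pow]
    gcongr
  have hAB : ∫⁻ p in S, A p.1 * B' p.2 ≤ ρ * (α * W) * (β * W') := by
    apply hsq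
    refine (sq_setLIntegral_prod_le_left hS hy hA hB').trans ?_
    rw [mul_pow, mul_pow]
    gcongr
  have hBA : ∫⁻ p in S, B p.1 * A' p.2 ≤ ρ * (β * W) * (α * W') := by
    apply hsq
    refine (sq_setLIntegral_prod_le_right hS hx hB hA').trans ?_
    rw [mul_pow, mul_pow]
    gcongr
  have hBB : ∫⁻ p in S, B p.1 * B' p.2 ≤ (β * W) * (β * W') :=
    (setLIntegral_prod_le_mul hB hB').trans (mul_le_mul' hβB hβB')
  refine (add_le_add (add_le_add hAA hAB) (add_le_add hBA hBB)).trans_eq ?_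
  ring

end SchurTest

/-! ### Duhamel's formula and the bilinear representation of the solution -/

/-- Duhamel's formula for `i Y' + p Y = F`. -/
theorem duhamel {p : ℝ} {Y F : ℝ → ℂ} {t : ℝ} (ht : 0 ≤ t)
    (hY : ∀ τ : ℝ, 0 ≤ τ → ∃ Y' : ℂ, HasDerivWithinAt Y Y' (Set.Ici 0) τ ∧
      I * Y' + (p : ℂ) * Y τ = F τ)
    (hF : IntervalIntegrable (fun τ : ℝ => cexp (-(I * τ * p)) * F τ) volume 0 t) :
    Y t = cexp (I * t * p) * (Y 0 - I * ∫ τ in (0 : ℝ)..t, cexp (-(I * τ * p)) * F τ) := by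
  have hexp : ∀ τ : ℝ, HasDerivAt (fun τ : ℝ => cexp (-(I * τ * p)))
      (cexp (-(I * τ * p)) * (-(I * p))) τ := by
    intro τ
    have h1 : HasDerivAt (fun τ : ℝ => -(I * (τ : ℂ) * p)) (-(I * p)) τ := by
      have := (((Complex.ofRealCLM.hasDerivAt (x := τ)).const_mul I).mul_const (p : ℂ)).neg
      convert! this using 1
      simp
    exact h1.cexp
  have hcont : ContinuousOn (fun τ : ℝ => cexp (-(I * τ * p)) * Y τ) (Set.Icc 0 t) := by
    intro τ hτ
    obtain ⟨Y', hY', -⟩ := hY τ hτ.1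
    exact (hexp τ).continuousAt.continuousWithinAt.mul
      (hY'.continuousWithinAt.mono Set.Icc_subset_Ici_self)
  have hder : ∀ τ ∈ Set.Ioo 0 t, HasDerivAt (fun τ : ℝ => cexp (-(I * τ * p)) * Y τ)
      (-I * (cexp (-(I * τ * p)) * F τ)) τ := by
    intro τ hτ
    obtain ⟨Y', hY', heq⟩ := hY τ hτ.1.le
    have h2 := (hexp τ).mul (hY'.hasDerivAt (Ici_mem_nhds hτ.1))
    convert! h2 using 1
    rw [← heq]
    linear_combination (-cexp (-(I * τ * p)) * Y') * I_mul_I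
  have h := intervalIntegral.integral_eq_sub_of_hasDerivAt_of_le ht hcont hder (hF.const_mul _)
  rw [intervalIntegral.integral_const_mul] at h
  have h0 : cexp (-(I * ((0 : ℝ) : ℂ) * p)) = 1 := by simp
  have h1 : cexp (I * t * p) * cexp (-(I * t * p)) = 1 := by rw [← Complex.exp_add]; simp
  rw [h0] at h
  linear_combination (-cexp (I * t * p)) * h - Y t * h1

/-- A solution of a homogeneous equation is given by the propagator. -/
theorem SolvesCauchy.hat_eq_of_homogeneous {p : ℝ → ℝ} {h : L2} {y : ℝ → L2}
    (hy : SolvesCauchy p (fun _ _ => 0) h y) {t : ℝ} (ht : 0 ≤ t) :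
    hat (y t) =ᵐ[volume] fun ξ => cexp (I * t * p ξ) * hat h ξ := by
  obtain ⟨Y, hY, hode⟩ := hy.equation
  have h0 := hY 0 le_rfl
  rw [hy.initial] at h0
  filter_upwards [hY t ht, h0, hode] with ξ h1 h2 h3
  have := duhamel ht h3 (by simp)
  simp only [mul_zero, intervalIntegral.integral_zero, sub_zero] at this
  rw [← h1, this, h2]

theorem memLp_hat (f : L2) : MemLp (hat f) 2 volume :=
  ⟨(measurable_hat f).aestronglyMeasurable, by
    rw [eLpNorm_hat]; exact (Lp.memLp f).2⟩

theorem integrable_hat_mul_hat (f g : L2) (ξ : ℝ) :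
    Integrable fun η : ℝ => hat f (ξ - η) * hat g η :=
  ((memLp_hat f).comp_measurePreserving
    (volume.measurePreserving_sub_left ξ)).integrable_mul (memLp_hat g)

/-- The oscillatory factor `∫₀ᵗ e^{iτy} dτ`. -/
def oscIntegral (t y : ℝ) : ℂ := ∫ τ in (0 : ℝ)..t, cexp (I * τ * y)

/-- The bilinear operator with symbol `m(ξ, η) k(φ(ξ, η))` on the frequency side. -/
def bilinearHat (m : ℝ × ℝ → ℂ) (φ : ℝ × ℝ → ℝ) (k : ℝ → ℂ) (f g : L2) (ξ : ℝ) : ℂ :=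
  ∫ η : ℝ, m (ξ - η, η) * k (φ (ξ - η, η)) * (hat f (ξ - η) * hat g η)

/-- Duhamel's formula for the solution of the system. -/
theorem IsSolution.hat_eq {a b c : ℝ → ℝ} {m : ℝ × ℝ → ℂ} {f g : L2} {u v w : ℝ → L2}
    (hb : Continuous b) (hc : Continuous c) (hm : Continuous m) (hm_supp : HasCompactSupport m)
    (h : IsSolution a b c m f g u v w) {t : ℝ} (ht : 0 ≤ t) :
    hat (u t) =ᵐ[volume] fun ξ => cexp (I * t * a ξ) *
      (-I * bilinearHat m (phase a b c) (oscIntegral t) f g ξ) := by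
  obtain ⟨Y, hY, hode⟩ := h.eq_u.equation
  have h0 := hY 0 le_rfl
  rw [h.eq_u.initial] at h0
  obtain ⟨M, hM⟩ := hm_supp.exists_bound_of_continuous hm
  -- The source is an integral in `η`, so the almost everywhere formulas for `v τ` and `w τ`
  -- determine it at every `ξ`, with no exceptional set depending on `τ`.
  have hpp : ∀ τ : ℝ, 0 ≤ τ → ∀ ξ, pseudoProductHat m (v τ) (w τ) ξ
      = ∫ η : ℝ, cexp (I * τ * (b (ξ - η) + c η)) *
          (m (ξ - η, η) * (hat f (ξ - η) * hat g η)) := by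
    intro τ hτ ξ
    refine integral_congr_ae ?_
    have e1 := (volume.measurePreserving_sub_left ξ).quasiMeasurePreserving.ae_eq_comp
      (h.eq_v.hat_eq_of_homogeneous hτ)
    filter_upwards [e1, h.eq_w.hat_eq_of_homogeneous hτ] with η h1 h2
    simp only [Function.comp] at h1
    rw [h1, h2, mul_add, Complex.exp_add]
    ring
  filter_upwards [hY t ht, h0, hat_zero, hode] with ξ h1 h2 h3 h4
  have hmeas1 := measurable_hat f
  have hmeas2 := measurable_hat g
  have hHint : Integrable fun η : ℝ => m (ξ - η, η) * (hat f (ξ - η) * hat g η) :=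
    (integrable_hat_mul_hat f g ξ).bdd_mul (c := M)
      (by fun_prop) (Filter.Eventually.of_forall fun η => hM _)
  set H : ℝ → ℂ := fun η => m (ξ - η, η) * (hat f (ξ - η) * hat g η) with hH
  set Ψ : ℝ → ℝ → ℂ := fun τ η => cexp (I * τ * phase a b c (ξ - η, η)) * H η with hΨ
  have hphase : Measurable fun η : ℝ => phase a b c (ξ - η, η) := by
    simp only [phase, sub_add_cancel]
    fun_prop
  have hnorm : ∀ τ y : ℝ, ‖cexp (I * τ * y)‖ = 1 := by
    intro τ y
    rw [mul_assoc, mul_comm I, ← Complex.ofReal_mul, Complex.norm_exp_ofReal_mul_I]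
  -- Absolute integrability on `(0, t] × ℝ` serves twice: it makes the source integrable in time,
  -- and it allows the exchange of integrals that produces `oscIntegral`.
  have hΨint : Integrable (Function.uncurry Ψ)
      ((volume.restrict (Set.uIoc 0 t)).prod volume) := by
    have h5 : Integrable (fun z : ℝ × ℝ => (1 : ℂ) * H z.2)
        ((volume.restrict (Set.uIoc 0 t)).prod volume) :=
      Integrable.mul_prod (f := fun _ : ℝ => (1 : ℂ))
        (integrable_const_iff.2 (Or.inr (by constructor; simp))) hHint
    simp only [one_mul] at h5
    refine h5.bdd_mul (c := 1) ?_ (Filter.Eventually.of_forall fun z => (hnorm _ _).le)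
    refine Measurable.aestronglyMeasurable ?_
    have hphase' : Measurable fun z : ℝ × ℝ => phase a b c (ξ - z.2, z.2) :=
      hphase.comp measurable_snd
    fun_prop
  have hduh : ∀ τ : ℝ, 0 ≤ τ →
      cexp (-(I * τ * a ξ)) * pseudoProductHat m (v τ) (w τ) ξ = ∫ η, Ψ τ η := by
    intro τ hτ
    rw [hpp τ hτ ξ, ← integral_const_mul]
    refine integral_congr_ae (Filter.Eventually.of_forall fun η => ?_)
    simp only [hΨ, hH, phase, sub_add_cancel]
    rw [← mul_assoc, ← Complex.exp_add]
    congr 2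
    push_cast
    ring
  have hcongr : Set.EqOn (fun τ : ℝ => ∫ η, Ψ τ η)
      (fun τ : ℝ => cexp (-(I * τ * a ξ)) * pseudoProductHat m (v τ) (w τ) ξ)
      (Set.uIcc 0 t) := by
    intro τ hτ
    rw [Set.uIcc_of_le ht] at hτ
    exact (hduh τ hτ.1).symm
  have hint : IntervalIntegrable (fun τ : ℝ => ∫ η, Ψ τ η) volume 0 t := by
    rw [intervalIntegrable_iff]
    exact hΨint.integral_prod_left
  have hY := duhamel ht h4 (hint.congr (fun τ hτ => hcongr (Set.uIoc_subset_uIcc hτ)))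
  rw [← intervalIntegral.integral_congr hcongr, intervalIntegral_integral_swap hΨint] at hY
  rw [← h1, hY, h2, h3, Pi.zero_apply, zero_sub, neg_mul]
  congr 3
  refine integral_congr_ae (Filter.Eventually.of_forall fun η => ?_)
  simp only [hΨ, hH]
  rw [intervalIntegral.integral_mul_const, ← oscIntegral]
  ring

/-! ### Bounds of the oscillatory factor -/

theorem norm_oscIntegral_le {t : ℝ} (ht : 0 ≤ t) (y : ℝ) : ‖oscIntegral t y‖ ≤ t := by
  have := intervalIntegral.norm_integral_le_of_norm_le_const (a := 0) (b := t) (C := 1)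
    (f := fun τ : ℝ => cexp (I * τ * y)) (fun τ _ => by
      rw [mul_assoc, mul_comm I, ← Complex.ofReal_mul, Complex.norm_exp_ofReal_mul_I])
  simpa [oscIntegral, abs_of_nonneg ht] using this

theorem norm_oscIntegral_le_div {y : ℝ} (hy : y ≠ 0) (t : ℝ) :
    ‖oscIntegral t y‖ ≤ 2 / |y| := by
  have h0 : I * (y : ℂ) ≠ 0 := mul_ne_zero I_ne_zero (by exact_mod_cast hy)
  have h1 : oscIntegral t y = (cexp (I * y * t) - cexp (I * y * (0 : ℝ))) / (I * y) := by
    rw [oscIntegral, ← integral_exp_mul_complex h0]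
    refine intervalIntegral.integral_congr fun τ _ => ?_
    ring_nf
  have hnorm : ∀ τ : ℝ, ‖cexp (I * y * τ)‖ = 1 := by
    intro τ
    rw [mul_assoc, mul_comm I, ← Complex.ofReal_mul, Complex.norm_exp_ofReal_mul_I]
  rw [h1, norm_div, norm_mul, norm_I, one_mul, Complex.norm_real, Real.norm_eq_abs]
  gcongr
  refine (norm_sub_le _ _).trans ?_
  rw [hnorm, hnorm]
  norm_num

theorem continuous_oscIntegral (t : ℝ) : Continuous (oscIntegral t) := by
  unfold oscIntegral
  exact intervalIntegral.continuous_parametric_intervalIntegral_of_continuous' (by fun_prop) 0 t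

/-! ### Weighted norms and dyadic decomposition in space -/

theorem eLpNorm_pow_eq_lintegral {α : Type*} [MeasurableSpace α] {μ : Measure α} (f : α → ℂ)
    {n : ℕ} (hn : n ≠ 0) : eLpNorm f n μ ^ n = ∫⁻ x, ‖f x‖ₑ ^ n ∂μ := by
  have := eLpNorm_nnreal_pow_eq_lintegral (μ := μ) (f := f) (p := (n : NNReal)) (by simpa using hn)
  simpa using this

theorem eLpNorm_two_sq {α : Type*} [MeasurableSpace α] {μ : Measure α} (f : α → ℂ) :
    eLpNorm f 2 μ ^ 2 = ∫⁻ x, ‖f x‖ₑ ^ 2 ∂μ :=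
  eLpNorm_pow_eq_lintegral f two_ne_zero

theorem eLpNorm_four_pow {α : Type*} [MeasurableSpace α] {μ : Measure α} (f : α → ℂ) :
    eLpNorm f 4 μ ^ 4 = ∫⁻ x, ‖f x‖ₑ ^ 4 ∂μ :=
  eLpNorm_pow_eq_lintegral f four_ne_zero

theorem ENNReal.le_of_pow_le_pow {x y : ℝ≥0∞} {n : ℕ} (hn : n ≠ 0) (h : x ^ n ≤ y ^ n) :
    x ≤ y :=
  (ENNReal.pow_right_strictMono hn).le_iff_le.1 h

theorem one_le_jap (x : ℝ) : 1 ≤ jap x := by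
  rw [jap, Real.one_le_sqrt]
  nlinarith [sq_nonneg x]

theorem abs_le_jap (x : ℝ) : |x| ≤ jap x :=
  Real.abs_le_sqrt (by linarith)

theorem measurable_jap : Measurable jap := by unfold jap; fun_prop

/-- The part of `f` lying in `{⟨x⟩ ≥ R}`. -/
theorem eLpNorm_indicator_le_weightedNorm (f : ℝ → ℂ) {s R : ℝ} (hs : 0 ≤ s) (hR : 0 < R)
    {E : Set ℝ} (hE : ∀ x ∈ E, R ≤ jap x) :
    eLpNorm (E.indicator f) 2 volume ≤ ENNReal.ofReal (R ^ (-s)) *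
      eLpNorm (fun x : ℝ => ((jap x ^ s : ℝ) : ℂ) * f x) 2 volume := by
  refine eLpNorm_le_mul_eLpNorm_of_ae_le_mul (Filter.Eventually.of_forall fun x => ?_) 2
  by_cases hx : x ∈ E
  · have h1 : 0 < jap x := hR.trans_le (hE x hx)
    rw [Set.indicator_of_mem hx, norm_mul, Complex.norm_real,
      Real.norm_of_nonneg (by positivity), ← mul_assoc]
    refine le_mul_of_one_le_left (norm_nonneg _) ?_
    rw [Real.rpow_neg hR.le, ← div_eq_inv_mul, one_le_div (by positivity)]
    exact Real.rpow_le_rpow hR.le (hE x hx) hs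
  · rw [Set.indicator_of_notMem hx, norm_zero]
    positivity

theorem eLpNorm_le_weightedNorm (f : L2) {s : ℝ} (hs : 0 ≤ s) :
    eLpNorm f 2 volume ≤ weightedNorm s f := by
  simpa [weightedNorm] using
    eLpNorm_indicator_le_weightedNorm f hs one_pos (E := Set.univ) (fun x _ => one_le_jap x)

theorem weightedNorm_zero (f : L2) : weightedNorm 0 f = eLpNorm f 2 volume := by
  simp [weightedNorm]

/-- The restriction of `f` to the measurable set `E`. -/
def cut {E : Set ℝ} (hE : MeasurableSet E) (f : L2) : L2 :=
  ((Lp.memLp f).indicator hE).toLp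

theorem coeFn_cut {E : Set ℝ} (hE : MeasurableSet E) (f : L2) :
    cut hE f =ᵐ[volume] E.indicator f :=
  MemLp.coeFn_toLp _

theorem eLpNorm_cut_le {E : Set ℝ} (hE : MeasurableSet E) (f : L2) {s R : ℝ} (hs : 0 ≤ s)
    (hR : 0 < R) (h : ∀ x ∈ E, R ≤ jap x) :
    eLpNorm (cut hE f) 2 volume ≤ ENNReal.ofReal (R ^ (-s)) * weightedNorm s f := by
  rw [eLpNorm_congr_ae (coeFn_cut hE f)]
  exact eLpNorm_indicator_le_weightedNorm f hs hR h

/-- Cauchy–Schwarz against the indicator of `E`; this gives the sup bound of the transform used for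
interpolation. -/
theorem sq_lintegral_cut_le {E : Set ℝ} (hE : MeasurableSet E) (f : L2) :
    (∫⁻ x, ‖cut hE f x‖ₑ) ^ 2 ≤ volume E * eLpNorm (cut hE f) 2 volume ^ 2 := by
  have hm : AEMeasurable fun x => ‖cut hE f x‖ₑ := by
    exact (Lp.stronglyMeasurable _).measurable.enorm.aemeasurable
  have h1 : ∫⁻ x, ‖cut hE f x‖ₑ = ∫⁻ x, E.indicator 1 x * ‖cut hE f x‖ₑ := by
    refine lintegral_congr_ae ?_
    filter_upwards [coeFn_cut hE f] with x hx
    by_cases h : x ∈ E <;> simp [hx, h]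
  rw [h1, eLpNorm_two_sq]
  refine (sq_lintegral_mul_le_mul ((measurable_one.indicator hE).aemeasurable) hm).trans_eq ?_
  congr 1
  rw [← lintegral_indicator_one hE]
  refine lintegral_congr fun x => ?_
  by_cases h : x ∈ E <;> simp [h]

/-- `L⁴` bound of the transform of a function supported on `E`, by interpolation of the `L²` and
the `L^∞` bounds. -/
theorem eLpNorm_hat_cut_pow_le {E : Set ℝ} (hE : MeasurableSet E) (f : L2) :
    eLpNorm (hat (cut hE f)) 4 volume ^ 4 ≤ volume E * eLpNorm (cut hE f) 2 volume ^ 4 := by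
  have hm := (measurable_hat (cut hE f)).enorm
  rw [eLpNorm_four_pow]
  calc ∫⁻ ξ, ‖hat (cut hE f) ξ‖ₑ ^ 4
      ≤ ∫⁻ ξ, (∫⁻ x, ‖cut hE f x‖ₑ) ^ 2 * ‖hat (cut hE f) ξ‖ₑ ^ 2 := by
        refine lintegral_mono_ae ?_
        filter_upwards [enorm_hat_le_lintegral (cut hE f)] with ξ h
        calc ‖hat (cut hE f) ξ‖ₑ ^ 4
            = ‖hat (cut hE f) ξ‖ₑ ^ 2 * ‖hat (cut hE f) ξ‖ₑ ^ 2 := by ring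
          _ ≤ _ := by gcongr
    _ = (∫⁻ x, ‖cut hE f x‖ₑ) ^ 2 * eLpNorm (cut hE f) 2 volume ^ 2 := by
        rw [lintegral_const_mul _ (hm.pow_const 2), ← eLpNorm_two_sq, eLpNorm_hat]
    _ ≤ (volume E * eLpNorm (cut hE f) 2 volume ^ 2) * eLpNorm (cut hE f) 2 volume ^ 2 := by
        gcongr
        exact sq_lintegral_cut_le hE f
    _ = _ := by ring

theorem measurableSet_outer (n : ℕ) : MeasurableSet {x : ℝ | 2 ^ n ≤ jap x} :=
  measurableSet_le measurable_const measurable_jap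

theorem measurableSet_shell (n : ℕ) : MeasurableSet {x : ℝ | 2 ^ n ≤ jap x ∧ jap x < 2 ^ (n + 1)} :=
  (measurableSet_outer n).inter (measurableSet_lt measurable_jap measurable_const)

theorem volume_shell_le (n : ℕ) :
    volume {x : ℝ | 2 ^ n ≤ jap x ∧ jap x < 2 ^ (n + 1)} ≤ ENNReal.ofReal (2 ^ (n + 2)) := by
  have hsub : {x : ℝ | 2 ^ n ≤ jap x ∧ jap x < 2 ^ (n + 1)} ⊆ Metric.ball 0 (2 ^ (n + 1)) := by
    rintro x ⟨-, hx⟩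
    rw [mem_ball_zero_iff, Real.norm_eq_abs]
    exact (abs_le_jap x).trans_lt hx
  refine (measure_mono hsub).trans ?_
  rw [Real.volume_ball]
  apply le_of_eq
  congr 1
  ring

/-- The fourth root of the volume of the shell costs `2^{(n+2)/4}`, while the weight gains
`2^{-sn}`: hence the threshold `s = 1/4`. -/
theorem eLpNorm_hat_cut_shell_le (f : L2) {s : ℝ} (hs : 0 ≤ s) (n : ℕ) :
    eLpNorm (hat (cut (measurableSet_shell n) f)) 4 volume
      ≤ ENNReal.ofReal (2 ^ ((n + 2) / 4 - s * n : ℝ)) * weightedNorm s f := by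
  apply ENNReal.le_of_pow_le_pow four_ne_zero
  refine (eLpNorm_hat_cut_pow_le _ f).trans ?_
  refine (mul_le_mul' (volume_shell_le n) (pow_le_pow_left' (eLpNorm_cut_le _ f hs
    (pow_pos two_pos n) (fun x hx => hx.1)) 4)).trans_eq ?_
  rw [mul_pow, mul_pow, ← mul_assoc, ← ENNReal.ofReal_pow (by positivity),
    ← ENNReal.ofReal_pow (by positivity), ← ENNReal.ofReal_mul (by positivity)]
  congr 2
  rw [← Real.rpow_natCast 2 n, ← Real.rpow_natCast 2 (n + 2), ← Real.rpow_mul zero_le_two,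
    ← Real.rpow_natCast (_ ^ _) 4, ← Real.rpow_natCast (_ ^ _) 4, ← Real.rpow_mul zero_le_two,
    ← Real.rpow_mul zero_le_two, ← Real.rpow_add two_pos]
  congr 1
  push_cast
  ring

theorem sum_cut_shell_add_cut_outer (f : L2) (n : ℕ) :
    ∑ k ∈ Finset.range n, cut (measurableSet_shell k) f + cut (measurableSet_outer n) f = f := by
  induction n with
  | zero =>
    simp only [Finset.range_zero, Finset.sum_empty, zero_add]
    refine Lp.ext ?_
    filter_upwards [coeFn_cut (measurableSet_outer 0) f] with x hx
    rw [hx, Set.indicator_of_mem]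
    simpa using one_le_jap x
  | succ n ih =>
    rw [Finset.sum_range_succ, add_assoc]
    convert ih using 2
    refine Lp.ext ?_
    filter_upwards [Lp.coeFn_add (cut (measurableSet_shell n) f) (cut (measurableSet_outer (n + 1)) f),
      coeFn_cut (measurableSet_outer n) f, coeFn_cut (measurableSet_shell n) f,
      coeFn_cut (measurableSet_outer (n + 1)) f] with x h1 h2 h3 h4
    rw [h1, Pi.add_apply, h2, h3, h4]
    have hmono : (2 : ℝ) ^ n ≤ 2 ^ (n + 1) := pow_le_pow_right₀ one_le_two (Nat.le_succ n)
    simp only [Set.indicator, Set.mem_ofPred_eq]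
    by_cases ha : 2 ^ n ≤ jap x
    · by_cases hb : 2 ^ (n + 1) ≤ jap x
      · simp [ha, hb, not_lt.2 hb]
      · simp [ha, hb, not_le.1 hb]
    · have hb : ¬ 2 ^ (n + 1) ≤ jap x := fun h => ha (hmono.trans h)
      simp [ha, hb]

/-- Splitting of `f` into a part whose transform is controlled in `L⁴` and a part small in `L²`. -/
theorem exists_split {s κ C : ℝ} (hs : 0 ≤ s)
    (hsum : ∀ n : ℕ, ∑ k ∈ Finset.range n, (2 : ℝ) ^ ((k + 2) / 4 - s * k : ℝ) ≤ C * 2 ^ (κ * n))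
    (f : L2) (n : ℕ) : ∃ fl fh : L2, fl + fh = f ∧
      eLpNorm (hat fl) 4 volume ≤ ENNReal.ofReal (C * 2 ^ (κ * n)) * weightedNorm s f ∧
      eLpNorm (hat fh) 2 volume ≤ ENNReal.ofReal (2 ^ (-(s * n))) * weightedNorm s f := by
  -- The first part collects the shells of index below `n`, estimated one by one in `L⁴`; the second
  -- is the region `⟨x⟩ ≥ 2^n`, where the weight alone gives the decay.
  refine ⟨_, _, sum_cut_shell_add_cut_outer f n, ?_, ?_⟩
  · rw [eLpNorm_congr_ae (hat_sum _ _)]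
    have h1 := eLpNorm_sum_le (μ := volume) (p := 4) (s := Finset.range n)
      (f := fun k => hat (cut (measurableSet_shell k) f))
      (fun k _ => (measurable_hat _).aestronglyMeasurable) (by norm_num)
    have h2 : (∑ k ∈ Finset.range n, hat (cut (measurableSet_shell k) f))
        = fun ξ => ∑ k ∈ Finset.range n, hat (cut (measurableSet_shell k) f) ξ := by
      ext ξ; simp
    rw [h2] at h1
    refine h1.trans ((Finset.sum_le_sum fun k _ => eLpNorm_hat_cut_shell_le f hs k).trans ?_)
    rw [← Finset.sum_mul, ← ENNReal.ofReal_sum_of_nonneg (fun k _ => by positivity)]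
    gcongr
    exact hsum n
  · rw [eLpNorm_hat]
    refine (eLpNorm_cut_le _ f hs (pow_pos two_pos n) (fun x hx => hx)).trans_eq ?_
    rw [← Real.rpow_natCast 2 n, ← Real.rpow_mul zero_le_two]
    congr 3
    ring

/-- Splitting of `|f̂|²` into a part controlled in `L²` and a part small in `L¹`. -/
theorem exists_sq_split {s κ C : ℝ} (hs : 0 ≤ s) (hC : 0 ≤ C)
    (hsum : ∀ n : ℕ, ∑ k ∈ Finset.range n, (2 : ℝ) ^ ((k + 2) / 4 - s * k : ℝ) ≤ C * 2 ^ (κ * n))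
    (f : L2) (n : ℕ) : ∃ A B : ℝ → ℝ≥0∞, Measurable A ∧ Measurable B ∧
      (∀ᵐ ξ : ℝ, ‖hat f ξ‖ₑ ^ 2 ≤ A ξ + B ξ) ∧
      ∫⁻ ξ, A ξ ^ 2 ≤ (ENNReal.ofReal (2 * (C * 2 ^ (κ * n)) ^ 2) * weightedNorm s f ^ 2) ^ 2 ∧
      ∫⁻ ξ, B ξ ≤ ENNReal.ofReal (2 * (2 ^ (-(s * n))) ^ 2) * weightedNorm s f ^ 2 := by
  obtain ⟨fl, fh, hf, hl, hh⟩ := exists_split hs hsum f n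
  have hml := (measurable_hat fl).enorm
  have hmh := (measurable_hat fh).enorm
  refine ⟨fun ξ => 2 * ‖hat fl ξ‖ₑ ^ 2, fun ξ => 2 * ‖hat fh ξ‖ₑ ^ 2, by fun_prop, by fun_prop,
    ?_, ?_, ?_⟩
  · have h1 := hat_add fl fh
    rw [hf] at h1
    filter_upwards [h1] with ξ hξ
    rw [hξ, Pi.add_apply]
    refine (pow_le_pow_left' (enorm_add_le _ _) 2).trans ?_
    have := ENNReal.rpow_add_le_mul_rpow_add_rpow ‖hat fl ξ‖ₑ ‖hat fh ξ‖ₑ (p := 2) one_le_two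
    norm_num at this
    rw [← mul_add]
    exact this
  · have h1 : ∀ ξ, (2 * ‖hat fl ξ‖ₑ ^ 2) ^ 2 = 4 * ‖hat fl ξ‖ₑ ^ 4 := by intro ξ; ring
    simp only [h1]
    rw [lintegral_const_mul _ (hml.pow_const 4), ← eLpNorm_four_pow]
    refine (mul_le_mul' le_rfl (pow_le_pow_left' hl 4)).trans_eq ?_
    rw [ENNReal.ofReal_mul zero_le_two, ENNReal.ofReal_pow (by positivity), ENNReal.ofReal_ofNat]
    ring
  · rw [lintegral_const_mul _ (hmh.pow_const 2), ← eLpNorm_two_sq]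
    refine (mul_le_mul' le_rfl (pow_le_pow_left' hh 2)).trans_eq ?_
    rw [ENNReal.ofReal_mul zero_le_two, ENNReal.ofReal_pow (by positivity), ENNReal.ofReal_ofNat]
    ring

/-! ### Interpolation and bounds for one dyadic piece -/

/-- Interpolation between `L²` and `L^∞`. -/
theorem eLpNorm_le_of_two_top {α : Type*} [MeasurableSpace α] {μ : Measure α} {f : α → ℂ}
    (hf : AEStronglyMeasurable f μ) {q : ℝ} (hq : 2 ≤ q) {X l : ℝ≥0∞}
    (h2 : eLpNorm f 2 μ ≤ l * X) (htop : eLpNorm f ⊤ μ ≤ X) :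
    eLpNorm f (ENNReal.ofReal q) μ ≤ l ^ (2 / q) * X := by
  have hq0 : 0 < q := by linarith
  rw [eLpNorm_eq_lintegral_rpow_enorm_toReal (by simpa using hq0) ENNReal.ofReal_ne_top,
    ENNReal.toReal_ofReal hq0.le]
  have hX : ∀ᵐ x ∂μ, ‖f x‖ₑ ≤ X := by
    rw [eLpNorm_exponent_top] at htop
    filter_upwards [enorm_ae_le_eLpNormEssSup f μ] with x hx
    exact hx.trans htop
  have key : ∫⁻ x, ‖f x‖ₑ ^ q ∂μ ≤ l ^ (2 : ℝ) * X ^ q := by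
    calc ∫⁻ x, ‖f x‖ₑ ^ q ∂μ ≤ ∫⁻ x, X ^ (q - 2) * ‖f x‖ₑ ^ 2 ∂μ := by
          refine lintegral_mono_ae ?_
          filter_upwards [hX] with x hx
          calc ‖f x‖ₑ ^ q = ‖f x‖ₑ ^ (q - 2) * ‖f x‖ₑ ^ (2 : ℝ) := by
                rw [← ENNReal.rpow_add_of_nonneg _ _ (by linarith) zero_le_two, sub_add_cancel]
            _ ≤ _ := by
                rw [ENNReal.rpow_two]
                gcongr
      _ ≤ X ^ (q - 2) * (l * X) ^ 2 := by
          rw [lintegral_const_mul'' _ (hf.enorm.pow_const 2), ← eLpNorm_two_sq]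
          gcongr
      _ = l ^ (2 : ℝ) * (X ^ (q - 2) * X ^ (2 : ℝ)) := by
          rw [ENNReal.rpow_two, ENNReal.rpow_two]; ring
      _ = _ := by
          rw [← ENNReal.rpow_add_of_nonneg _ _ (by linarith) zero_le_two, sub_add_cancel]
  refine (ENNReal.rpow_le_rpow key (by positivity)).trans_eq ?_
  rw [ENNReal.mul_rpow_of_nonneg _ _ (by positivity), ← ENNReal.rpow_mul, ← ENNReal.rpow_mul,
    mul_one_div_cancel hq0.ne', ENNReal.rpow_one, mul_one_div]

theorem stronglyMeasurable_bilinearHat {m : ℝ × ℝ → ℂ} {φ : ℝ × ℝ → ℝ} {k : ℝ → ℂ}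
    (hm : Continuous m) (hφ : Continuous φ) (hk : Measurable k) (f g : L2) :
    StronglyMeasurable (bilinearHat m φ k f g) := by
  have h1 := measurable_hat f
  have h2 := measurable_hat g
  unfold bilinearHat
  refine StronglyMeasurable.integral_prod_right (f := fun (ξ η : ℝ) =>
    m (ξ - η, η) * k (φ (ξ - η, η)) * (hat f (ξ - η) * hat g η)) ?_
  refine Measurable.stronglyMeasurable ?_
  have h3 : Measurable fun p : ℝ × ℝ => k (φ (p.1 - p.2, p.2)) :=
    hk.comp (by fun_prop)
  unfold Function.uncurry
  fun_prop

/-- Pointwise domination by an integral over the strip `{|φ| ≤ δ}`. -/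
theorem enorm_bilinearHat_le {m : ℝ × ℝ → ℂ} {φ : ℝ × ℝ → ℝ} {k : ℝ → ℂ}
    (hφ : Continuous φ) {M N δ : ℝ} (hM0 : 0 ≤ M)
    (hM : ∀ p, ‖m p‖ ≤ M) (hN : ∀ y, ‖k y‖ ≤ N) (hδ : ∀ y, δ < |y| → k y = 0) (f g : L2) (ξ : ℝ) :
    ‖bilinearHat m φ k f g ξ‖ₑ ≤ ENNReal.ofReal (M * N) *
      ∫⁻ η in {η | (ξ - η, η) ∈ {p | p ∈ tsupport m ∧ |φ p| ≤ δ}},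
        ‖hat f (ξ - η)‖ₑ * ‖hat g η‖ₑ := by
  have hS : MeasurableSet {η : ℝ | (ξ - η, η) ∈ {p | p ∈ tsupport m ∧ |φ p| ≤ δ}} := by
    have h1 : IsClosed {p : ℝ × ℝ | p ∈ tsupport m ∧ |φ p| ≤ δ} :=
      (isClosed_tsupport m).inter (isClosed_le hφ.abs continuous_const)
    exact (by fun_prop : Measurable fun η : ℝ => (ξ - η, η)) h1.measurableSet
  have h1 := measurable_hat f
  have h2 := measurable_hat g
  rw [← lintegral_const_mul _ (by fun_prop), ← lintegral_indicator hS]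
  refine (enorm_integral_le_lintegral_enorm _).trans (lintegral_mono fun η => ?_)
  by_cases hη : (ξ - η, η) ∈ {p | p ∈ tsupport m ∧ |φ p| ≤ δ}
  · rw [Set.indicator_of_mem (by exact hη), enorm_mul, enorm_mul (hat f _)]
    refine mul_le_mul' ?_ le_rfl
    rw [← ofReal_norm, norm_mul]
    gcongr
    · exact hM _
    · exact hN _
  · rw [Set.indicator_of_notMem (by exact hη)]
    have h0 : m (ξ - η, η) * k (φ (ξ - η, η)) = 0 := by
      rw [Set.mem_ofPred_eq, not_and_or, not_le] at hη
      rcases hη with hη | hη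
      · rw [image_eq_zero_of_notMem_tsupport hη, zero_mul]
      · rw [hδ _ hη, mul_zero]
    simp [h0]

/-- The `L¹` and `L²` bounds of the transform of a dyadic piece of the bilinear operator. -/
theorem exists_bilinearHat_bounds {m : ℝ × ℝ → ℂ} {φ : ℝ × ℝ → ℝ} (hm : Continuous m)
    (hm_supp : HasCompactSupport m) (hφ : ContDiff ℝ 1 φ)
    (hΓ : ∀ p ∈ tsupport m, φ p = 0 → ∀ d ∈ characteristicDirections, fderiv ℝ φ p d ≠ 0)
    {s κ C₀ B : ℝ} (hs : 0 ≤ s) (hsκ : 1 / 4 ≤ s + κ) (hC₀ : 0 ≤ C₀) (hB : 0 < B)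
    (hsum : ∀ n : ℕ, ∑ k ∈ Finset.range n, (2 : ℝ) ^ ((k + 2) / 4 - s * k : ℝ)
      ≤ C₀ * 2 ^ (κ * n)) :
    ∃ C : ℝ, 0 < C ∧ ∀ (A : ℝ) (j : ℕ) (k : ℝ → ℂ), 0 ≤ A → Measurable k →
      (∀ y, ‖k y‖ ≤ A * 2 ^ j) → (∀ y, B / 2 ^ j < |y| → k y = 0) → ∀ f g : L2,
      ∫⁻ ξ, ‖bilinearHat m φ k f g ξ‖ₑ
        ≤ ENNReal.ofReal (C * A) * (eLpNorm f 2 volume * eLpNorm g 2 volume) ∧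
      eLpNorm (bilinearHat m φ k f g) 2 volume
        ≤ ENNReal.ofReal (C * A * 2 ^ (2 * κ * j)) * (weightedNorm s f * weightedNorm s g) := by
  obtain ⟨M, hM⟩ := hm_supp.exists_bound_of_continuous hm
  have hM0 : 0 ≤ M := (norm_nonneg _).trans (hM 0)
  have slice : ∀ d ∈ characteristicDirections, ∃ C : ℝ, 0 ≤ C ∧ ∀ (p : ℝ × ℝ) (δ : ℝ), 0 < δ →
      volume {τ : ℝ | p + τ • d ∈ tsupport m ∧ |φ (p + τ • d)| ≤ δ} ≤ ENNReal.ofReal (C * δ) := by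
    intro d hd
    refine exists_volume_slice_le hφ hm_supp ?_ (fun p hp h0 => hΓ p hp h0 d hd)
    rintro rfl
    simp [characteristicDirections, Prod.ext_iff] at hd
  obtain ⟨C₁, hC₁, H₁⟩ := slice (1, 0) (by simp [characteristicDirections])
  obtain ⟨C₂, hC₂, H₂⟩ := slice (0, 1) (by simp [characteristicDirections])
  obtain ⟨C₃, hC₃, H₃⟩ := slice (1, -1) (by simp [characteristicDirections])
  set D := C₁ + C₂ + C₃ with hD
  have hD0 : 0 ≤ D := by positivity
  -- The slices have length at most `Dδ = DB/2^j`, which is `ρ²` for `ρ = r 2^{-j/2}`.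
  set r := √(D * B) with hr
  have hr2 : r ^ 2 = D * B := Real.sq_sqrt (by positivity)
  -- The first summand serves the `L¹` bound, the second the `L²` bound; the 1 ensures positivity.
  refine ⟨M * r ^ 2 + M * (r * (r * (2 * C₀ ^ 2) + 2)) + 1, by positivity, ?_⟩
  intro A j k hA hk hkN hkδ f g
  set δ := B / 2 ^ j with hδ
  have hδ0 : 0 < δ := by positivity
  set S : Set (ℝ × ℝ) := {p | p ∈ tsupport m ∧ |φ p| ≤ δ} with hSdef
  have hS : MeasurableSet S :=
    ((isClosed_tsupport m).inter (isClosed_le hφ.continuous.abs continuous_const)).measurableSet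
  set ρ : ℝ≥0∞ := ENNReal.ofReal (r * 2 ^ (-(j / 2 : ℝ))) with hρ
  have hpow : ((2 : ℝ) ^ (-(j / 2 : ℝ))) ^ 2 = (2 ^ j)⁻¹ := by
    rw [← Real.rpow_natCast (_ ^ _) 2, ← Real.rpow_mul zero_le_two, ← Real.rpow_natCast 2 j,
      ← Real.rpow_neg zero_le_two]
    congr 1
    push_cast
    ring
  have hρ2 : ENNReal.ofReal (D * δ) = ρ ^ 2 := by
    rw [hρ, ← ENNReal.ofReal_pow (by positivity), mul_pow, hpow, hr2, hδ]
    congr 1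
    ring
  have hle : ∀ C : ℝ, C ≤ D → ENNReal.ofReal (C * δ) ≤ ρ ^ 2 := by
    intro C hC
    rw [← hρ2]
    gcongr
  have hx : ∀ x : ℝ, volume {y : ℝ | (x, y) ∈ S} ≤ ρ ^ 2 := by
    intro x
    have := H₂ (x, 0) δ hδ0
    simp only [Prod.smul_mk, smul_eq_mul, mul_zero, mul_one, Prod.mk_add_mk, add_zero,
      zero_add] at this
    exact this.trans (hle _ (by linarith))
  have hy : ∀ y : ℝ, volume {x : ℝ | (x, y) ∈ S} ≤ ρ ^ 2 := by
    intro y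
    have := H₁ (0, y) δ hδ0
    simp only [Prod.smul_mk, smul_eq_mul, mul_zero, mul_one, Prod.mk_add_mk, add_zero,
      zero_add] at this
    exact this.trans (hle _ (by linarith))
  have hd : ∀ ξ : ℝ, volume {η : ℝ | (ξ - η, η) ∈ S} ≤ ρ ^ 2 := by
    intro ξ
    -- The line through `(0, ξ)` is parametrised by its first coordinate; the reflection `η ↦ ξ - η`
    -- passes to the second one and preserves length.
    have h1 := H₃ (0, ξ) δ hδ0
    simp only [Prod.smul_mk, smul_eq_mul, mul_one, Prod.mk_add_mk, zero_add, mul_neg,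
      ← sub_eq_add_neg] at h1
    have h2 := (volume.measurePreserving_sub_left ξ).measure_preimage
      (s := {η : ℝ | (ξ - η, η) ∈ S})
      ((by fun_prop : Measurable fun η : ℝ => (ξ - η, η)) hS).nullMeasurableSet
    rw [← h2]
    simp only [Set.preimage_ofPred_eq, sub_sub_cancel]
    exact h1.trans (hle _ (by linarith))
  have hF := (measurable_hat f).enorm
  have hG := (measurable_hat g).enorm
  have hptw := fun ξ => enorm_bilinearHat_le (m := m) (k := k) hφ.continuous hM0 hM hkN hkδ f g ξ
  have hmono : ∀ x y : ℝ≥0∞, ∀ {u v : ℝ}, u ≤ v → ENNReal.ofReal u * (x * y)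
      ≤ ENNReal.ofReal v * (x * y) := fun x y u v h => by gcongr
  refine ⟨?_, ?_⟩
  · refine (lintegral_mono hptw).trans ?_
    rw [lintegral_const_mul' _ _ ENNReal.ofReal_ne_top, lintegral_convolution_eq hS hF hG]
    have h1 : ∫⁻ p in S, ‖hat f p.1‖ₑ * ‖hat g p.2‖ₑ
        ≤ ρ ^ 2 * (eLpNorm f 2 volume * eLpNorm g 2 volume) := by
      apply ENNReal.le_of_pow_le_pow two_ne_zero
      refine (sq_setLIntegral_prod_le hS hx hy hF hG).trans_eq ?_
      rw [← eLpNorm_two_sq, ← eLpNorm_two_sq, eLpNorm_hat, eLpNorm_hat]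
      ring
    refine (mul_le_mul' le_rfl h1).trans ?_
    rw [← mul_assoc, ← hρ2, ← ENNReal.ofReal_mul (by positivity)]
    apply hmono
    have e : M * (A * 2 ^ j) * (D * δ) = M * r ^ 2 * A := by
      rw [hr2, hδ]; field_simp
    rw [e]
    refine mul_le_mul_of_nonneg_right ?_ hA
    have : 0 ≤ M * (r * (r * (2 * C₀ ^ 2) + 2)) := by positivity
    linarith
  -- The spatial cut is made at the scale `2^j`, tied to the width `2^{-j}` of the strip.
  · obtain ⟨P, R, hPm, hRm, hPR, hP, hR⟩ := exists_sq_split hs hC₀ hsum f j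
    obtain ⟨P', R', hPm', hRm', hPR', hP', hR'⟩ := exists_sq_split hs hC₀ hsum g j
    have h1 := lintegral_sq_convolution_le_of_split hS hx hy hd hF hG hPm hRm hPm' hRm' hPR hPR'
      hP hR hP' hR'
    set α : ℝ := 2 * (C₀ * 2 ^ (κ * j)) ^ 2 with hα
    set β : ℝ := 2 * (2 ^ (-(s * j))) ^ 2 with hβ
    have h2 : eLpNorm (bilinearHat m φ k f g) 2 volume ≤ ENNReal.ofReal (M * (A * 2 ^ j)) *
        (ρ * (ρ * ENNReal.ofReal α + ENNReal.ofReal β) * (weightedNorm s f * weightedNorm s g)) := by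
      apply ENNReal.le_of_pow_le_pow two_ne_zero
      rw [eLpNorm_two_sq, mul_pow]
      refine (lintegral_mono fun ξ => pow_le_pow_left' (hptw ξ) 2).trans ?_
      simp only [mul_pow (ENNReal.ofReal _)]
      rw [lintegral_const_mul' _ _ (ENNReal.pow_ne_top ENNReal.ofReal_ne_top)]
      refine mul_le_mul' le_rfl (h1.trans_eq ?_)
      ring
    refine h2.trans ?_
    rw [hρ, ← ENNReal.ofReal_mul (by positivity), ← ENNReal.ofReal_add (by positivity)
      (by positivity), ← ENNReal.ofReal_mul (by positivity), ← mul_assoc,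
      ← ENNReal.ofReal_mul (by positivity)]
    apply hmono
    set z : ℝ := 2 ^ (-(j / 2 : ℝ)) with hz
    have hz0 : 0 < z := by positivity
    have hzj : (2 : ℝ) ^ j * z ^ 2 = 1 := by
      rw [hpow, mul_inv_cancel₀ (by positivity)]
    have hα' : α = 2 * C₀ ^ 2 * 2 ^ (2 * κ * j) := by
      rw [hα, mul_pow, ← Real.rpow_natCast (_ ^ _) 2, ← Real.rpow_mul zero_le_two, ← mul_assoc]
      congr 2
      push_cast
      ring
    -- The remainder `2^{-2sj}` is absorbed in `2^{-j/2} 2^{2κj}` exactly because `s + κ ≥ 1/4`.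
    have hβ' : β ≤ 2 * (z * 2 ^ (2 * κ * j)) := by
      rw [hβ, ← Real.rpow_natCast (_ ^ _) 2, ← Real.rpow_mul zero_le_two, hz,
        ← Real.rpow_add two_pos]
      refine mul_le_mul_of_nonneg_left (Real.rpow_le_rpow_of_exponent_le one_le_two ?_) zero_le_two
      push_cast
      nlinarith [Nat.cast_nonneg (α := ℝ) j]
    calc M * (A * 2 ^ j) * (r * z * (r * z * α + β))
        ≤ M * (A * 2 ^ j) * (r * z * (r * z * (2 * C₀ ^ 2 * 2 ^ (2 * κ * j))
            + 2 * (z * 2 ^ (2 * κ * j)))) := by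
          rw [hα']
          gcongr
      _ = M * (r * (r * (2 * C₀ ^ 2) + 2)) * A * 2 ^ (2 * κ * j) * (2 ^ j * z ^ 2) := by ring
      _ ≤ _ := by
          rw [hzj, mul_one]
          gcongr
          have : 0 ≤ M * r ^ 2 := by positivity
          linarith

/-! ### Summation of the spatial shells below and above `s = 1/4` -/

theorem sum_rpow_le_of_lt {s : ℝ} (hs : s < 1 / 4) : ∃ C : ℝ, 0 ≤ C ∧ ∀ n : ℕ,
    ∑ k ∈ Finset.range n, (2 : ℝ) ^ ((k + 2) / 4 - s * k : ℝ) ≤ C * 2 ^ ((1 / 4 - s) * n) := by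
  set x : ℝ := 2 ^ (1 / 4 - s) with hx
  have hx1 : 1 < x := Real.one_lt_rpow one_lt_two (by linarith)
  refine ⟨2 ^ (1 / 2 : ℝ) / (x - 1), div_nonneg (by positivity) (by linarith), fun n => ?_⟩
  have h1 : ∀ k : ℕ, (2 : ℝ) ^ ((k + 2) / 4 - s * k : ℝ) = 2 ^ (1 / 2 : ℝ) * x ^ k := by
    intro k
    rw [hx, ← Real.rpow_natCast (_ ^ _) k, ← Real.rpow_mul zero_le_two, ← Real.rpow_add two_pos]
    congr 1
    ring
  have h2 : (2 : ℝ) ^ ((1 / 4 - s) * n) = x ^ n := by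
    rw [hx, ← Real.rpow_natCast (_ ^ _) n, ← Real.rpow_mul zero_le_two]
  simp only [h1, h2]
  rw [← Finset.mul_sum, geom_sum_eq hx1.ne', div_mul_eq_mul_div, mul_div_assoc]
  have : 0 < x - 1 := by linarith
  gcongr
  linarith

theorem sum_rpow_le_of_gt {s : ℝ} (hs : 1 / 4 < s) : ∃ C : ℝ, 0 ≤ C ∧ ∀ n : ℕ,
    ∑ k ∈ Finset.range n, (2 : ℝ) ^ ((k + 2) / 4 - s * k : ℝ) ≤ C * 2 ^ ((0 : ℝ) * n) := by
  set x : ℝ := 2 ^ (1 / 4 - s) with hx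
  have hx1 : x < 1 := Real.rpow_lt_one_of_one_lt_of_neg one_lt_two (by linarith)
  have hx0 : 0 ≤ x := by positivity
  refine ⟨2 ^ (1 / 2 : ℝ) * (1 - x)⁻¹, mul_nonneg (by positivity)
    (inv_nonneg.2 (by linarith)), fun n => ?_⟩
  have h1 : ∀ k : ℕ, (2 : ℝ) ^ ((k + 2) / 4 - s * k : ℝ) = 2 ^ (1 / 2 : ℝ) * x ^ k := by
    intro k
    rw [hx, ← Real.rpow_natCast (_ ^ _) k, ← Real.rpow_mul zero_le_two, ← Real.rpow_add two_pos]
    congr 1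
    ring
  simp only [h1, zero_mul, Real.rpow_zero, mul_one]
  rw [← Finset.mul_sum, ← tsum_geometric_of_lt_one hx0 hx1]
  gcongr
  exact (summable_geometric_of_lt_one hx0 hx1).sum_le_tsum _ (fun i _ => pow_nonneg hx0 i)

/-! ### Dyadic decomposition in the size of the phase -/

/-- Dyadic decomposition of the oscillatory factor according to the size of `|y|`. -/
theorem exists_oscIntegral_decomposition {B t : ℝ} (hB : 1 ≤ B) (ht : 0 < t) :
    ∃ (J : ℕ) (k : ℕ → ℝ → ℂ), (2 : ℝ) ^ J ≤ max 1 t ∧ (∀ j, Measurable (k j)) ∧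
      (∀ j y, ‖k j y‖ ≤ 4 * min 1 t * 2 ^ j) ∧ (∀ j y, B / 2 ^ j < |y| → k j y = 0) ∧
      ∀ y, |y| ≤ B → oscIntegral t y = ∑ j ∈ Finset.range (J + 1), k j y := by
  -- `J` is the largest integer with `2^J ≤ t`, or 0 if `t < 1`.
  obtain ⟨J, hJ1, hJ2, hJ3⟩ : ∃ J : ℕ, (2 : ℝ) ^ J ≤ max 1 t ∧ t ≤ 2 * min 1 t * 2 ^ J ∧
      (t < 1 → J = 0) := by
    rcases lt_or_ge t 1 with h | h
    · refine ⟨0, by simp, ?_, fun _ => rfl⟩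
      rw [min_eq_right h.le]; simp; linarith
    · obtain ⟨J, h1, h2⟩ := exists_nat_pow_near h one_lt_two
      refine ⟨J, h1.trans (le_max_right _ _), ?_, fun h' => absurd h (not_le.2 h')⟩
      rw [min_eq_left h]
      rw [pow_succ] at h2
      linarith
  have hE := continuous_oscIntegral t
  have hmin : 0 < min 1 t := lt_min one_pos ht
  -- Sharp truncations suffice, as only the size and the support of the pieces matter; the
  -- differences telescope, and the innermost truncation is kept whole.
  set χ : ℕ → ℝ → ℂ := fun j y => if |y| ≤ B / 2 ^ j then oscIntegral t y else 0 with hχ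
  have hχm : ∀ j, Measurable (χ j) := fun j =>
    Measurable.ite (measurableSet_le (by fun_prop) measurable_const) hE.measurable measurable_const
  refine ⟨J, fun j y => if j < J then χ j y - χ (j + 1) y else if j = J then χ J y else 0,
    hJ1, ?_, ?_, ?_, ?_⟩
  · intro j
    by_cases h : j < J
    · simp only [h, if_true]
      exact (hχm j).sub (hχm (j + 1))
    · by_cases h' : j = J
      · simp only [if_false, h', lt_irrefl, if_true]
        exact hχm J
      · simp only [h, if_false, h', measurable_const]
  · intro j y
    have hnn : 0 ≤ 4 * min 1 t * (2 : ℝ) ^ j := by positivity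
    have hmono : B / 2 ^ (j + 1) ≤ B / 2 ^ j := by
      have : (2 : ℝ) ^ j ≤ 2 ^ (j + 1) := pow_le_pow_right₀ one_le_two (Nat.le_succ j)
      gcongr
    by_cases h : j < J
    · simp only [h, if_true, hχ]
      by_cases h1 : |y| ≤ B / 2 ^ (j + 1)
      · simpa only [h1, h1.trans hmono, if_true, sub_self, norm_zero] using hnn
      · by_cases h2 : |y| ≤ B / 2 ^ j
        · simp only [h1, h2, if_true, if_false, sub_zero]
          -- A proper shell `j < J` occurs only when `t ≥ 1`. There `|y| > 2^{-(j+1)}`, so `2/|y|`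
          -- is at most `4 · 2^j`.
          have ht1 : 1 ≤ t := by
            by_contra h3
            have := hJ3 (not_le.1 h3)
            omega
          rw [min_eq_left ht1]
          have hy : 1 / 2 ^ (j + 1) < |y| :=
            lt_of_le_of_lt (by gcongr) (not_le.1 h1)
          have hy0 : 0 < |y| := lt_trans (by positivity) hy
          refine (norm_oscIntegral_le_div (abs_pos.1 hy0) t).trans ?_
          rw [div_le_iff₀ hy0]
          rw [div_lt_iff₀ (by positivity), pow_succ] at hy
          nlinarith
        · simpa only [h1, h2, if_false, sub_zero, norm_zero] using hnn
    · by_cases h' : j = J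
      · subst h'
        simp only [lt_irrefl, if_true, if_false, hχ]
        split_ifs
        · refine (norm_oscIntegral_le ht.le y).trans (hJ2.trans ?_)
          gcongr
          norm_num
        · simpa using hnn
      · simpa only [h, h', if_false, norm_zero] using hnn
  · intro j y hy
    have h2 : ¬ |y| ≤ B / 2 ^ (j + 1) := by
      have : (2 : ℝ) ^ j ≤ 2 ^ (j + 1) := pow_le_pow_right₀ one_le_two (Nat.le_succ j)
      have h3 : B / 2 ^ (j + 1) ≤ B / 2 ^ j := by gcongr
      exact not_le.2 (h3.trans_lt hy)
    by_cases h' : j = J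
    · subst h'
      simp [hχ, not_le.2 hy]
    · simp [hχ, not_le.2 hy, h2, h']
  · intro y hy
    rw [Finset.sum_range_succ]
    simp only [lt_irrefl, if_true, if_false]
    have h1 : ∑ j ∈ Finset.range J,
        (if j < J then χ j y - χ (j + 1) y else if j = J then χ J y else 0)
        = ∑ j ∈ Finset.range J, (χ j y - χ (j + 1) y) :=
      Finset.sum_congr rfl fun j hj => by simp [Finset.mem_range.1 hj]
    rw [h1, Finset.sum_range_sub', sub_add_cancel]
    simp [hχ, hy]

/-! ### Assembling the pieces of the solution -/

theorem eLpNorm_sum_coeFn_le {p : ℝ≥0∞} (hp : 1 ≤ p) {ι : Type*} (s : Finset ι) (y : ι → L2) :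
    eLpNorm (∑ i ∈ s, y i : L2) p volume ≤ ∑ i ∈ s, eLpNorm (y i) p volume := by
  classical
  induction s using Finset.induction_on with
  | empty =>
    rw [Finset.sum_empty, Finset.sum_empty, eLpNorm_congr_ae (Lp.coeFn_zero _ _ _), eLpNorm_zero]
  | insert i s hi ih =>
    rw [Finset.sum_insert hi, Finset.sum_insert hi, eLpNorm_congr_ae (Lp.coeFn_add _ _)]
    exact (eLpNorm_add_le (Lp.stronglyMeasurable _).aestronglyMeasurable
      (Lp.stronglyMeasurable _).aestronglyMeasurable hp).trans (add_le_add le_rfl ih)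

/-- The solution is a sum of about `log t` dyadic pieces, with uniform `L^∞` bounds and
geometrically growing `L²` bounds. -/
theorem exists_solution_decomposition {a b c : ℝ → ℝ} {m : ℝ × ℝ → ℂ}
    (ha : ContDiff ℝ 1 a) (hb : ContDiff ℝ 1 b) (hc : ContDiff ℝ 1 c) (hm : Continuous m)
    (hm_supp : HasCompactSupport m) (hΓ : NonCharacteristicOn (phase a b c) (tsupport m))
    {s κ C₀ : ℝ} (hs : 0 ≤ s) (hsκ : 1 / 4 ≤ s + κ) (hC₀ : 0 ≤ C₀)
    (hsum : ∀ n : ℕ, ∑ k ∈ Finset.range n, (2 : ℝ) ^ ((k + 2) / 4 - s * k : ℝ)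
      ≤ C₀ * 2 ^ (κ * n)) :
    ∃ C : ℝ, 0 < C ∧ ∀ (f g : L2) (u v w : ℝ → L2), IsSolution a b c m f g u v w →
      ∀ t : ℝ, 0 < t → ∃ (J : ℕ) (y : ℕ → L2), (2 : ℝ) ^ J ≤ max 1 t ∧
        u t = ∑ j ∈ Finset.range (J + 1), y j ∧ ∀ j,
          eLpNorm (y j) ⊤ volume
            ≤ ENNReal.ofReal (C * min 1 t) * (eLpNorm f 2 volume * eLpNorm g 2 volume) ∧
          eLpNorm (y j) 2 volume ≤ ENNReal.ofReal (C * min 1 t * 2 ^ (2 * κ * j)) *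
            (weightedNorm s f * weightedNorm s g) := by
  have hφ : ContDiff ℝ 1 (phase a b c) := by
    unfold phase
    fun_prop
  have hΓ' : ∀ p ∈ tsupport m, phase a b c p = 0 → ∀ d ∈ characteristicDirections,
      fderiv ℝ (phase a b c) p d ≠ 0 :=
    fun p hp h0 d hd h => hΓ p ⟨h0, hp⟩ d hd (by simpa [LinearMap.mem_ker] using h)
  obtain ⟨B₀, hB₀⟩ := hm_supp.exists_bound_of_continuousOn (f := phase a b c)
    hφ.continuous.continuousOn
  set B := max 1 B₀ with hB
  have hB1 : 1 ≤ B := le_max_left _ _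
  have hφB : ∀ p ∈ tsupport m, |phase a b c p| ≤ B := fun p hp =>
    (hB₀ p hp).trans (le_max_right _ _)
  -- The unweighted case `s = 0`, `κ = 1/4` shows that every piece is in `L²` even when the weighted
  -- norms are infinite, so that it has an inverse transform.
  obtain ⟨D₀, hD₀, hsum₀⟩ := sum_rpow_le_of_lt (s := 0) (by norm_num)
  obtain ⟨C₁, -, H₁⟩ := exists_bilinearHat_bounds hm hm_supp hφ hΓ' le_rfl
    (by norm_num) hD₀ (one_pos.trans_le hB1) hsum₀
  obtain ⟨C, hC, H⟩ := exists_bilinearHat_bounds hm hm_supp hφ hΓ' hs hsκ hC₀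
    (one_pos.trans_le hB1) hsum
  refine ⟨4 * C, by positivity, fun f g u v w hsol t ht => ?_⟩
  obtain ⟨J, k, hJ, hkm, hkN, hkδ, hkE⟩ := exists_oscIntegral_decomposition hB1 ht
  have hmin : 0 < min 1 t := lt_min one_pos ht
  have hA : 0 ≤ 4 * min 1 t := by positivity
  set Q : ℕ → ℝ → ℂ := fun j => bilinearHat m (phase a b c) (k j) f g with hQ
  set U : ℕ → ℝ → ℂ := fun j ξ => cexp (I * t * a ξ) * (-I * Q j ξ) with hU
  have hQm : ∀ j, StronglyMeasurable (Q j) := fun j =>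
    stronglyMeasurable_bilinearHat hm hφ.continuous (hkm j) f g
  have hUm : ∀ j, AEStronglyMeasurable (U j) volume := by
    intro j
    have h1 := (hQm j).measurable
    have h2 := ha.continuous.measurable
    exact Measurable.aestronglyMeasurable (by fun_prop)
  have hUn : ∀ j ξ, ‖U j ξ‖ₑ = ‖Q j ξ‖ₑ := by
    intro j ξ
    have h1 : ‖cexp (I * t * a ξ)‖ = 1 := by
      rw [mul_assoc, mul_comm I, ← Complex.ofReal_mul, Complex.norm_exp_ofReal_mul_I]
    rw [← ofReal_norm, ← ofReal_norm, norm_mul, norm_mul, h1, norm_neg, norm_I, one_mul, one_mul]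
  have hUL : ∀ j, eLpNorm (U j) 2 volume = eLpNorm (Q j) 2 volume := fun j =>
    eLpNorm_congr_enorm_ae (Filter.Eventually.of_forall (hUn j))
  have hUmem : ∀ j, MemLp (U j) 2 volume := by
    intro j
    refine ⟨hUm j, ?_⟩
    rw [hUL]
    refine ((H₁ _ j (k j) hA (hkm j) (hkN j) (hkδ j) f g).2).trans_lt ?_
    rw [weightedNorm_zero, weightedNorm_zero]
    exact ENNReal.mul_lt_top ENNReal.ofReal_lt_top
      (ENNReal.mul_lt_top (Lp.eLpNorm_lt_top f) (Lp.eLpNorm_lt_top g))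
  choose y hy hytop using fun j => exists_hat_eq (hUmem j)
  refine ⟨J, y, hJ, ?_, fun j => ⟨?_, ?_⟩⟩
  · apply hat_injective
    have hall : ∀ᵐ ξ : ℝ, ∀ j, hat (y j) ξ = U j ξ := ae_all_iff.2 hy
    filter_upwards [hsol.hat_eq hb.continuous hc.continuous hm hm_supp ht.le,
      hat_sum (Finset.range (J + 1)) y, hall] with ξ h1 h2 h3
    rw [h1, h2]
    simp only [h3, hU]
    rw [← Finset.mul_sum, ← Finset.mul_sum]
    congr 2
    have hint : ∀ j, Integrable fun η : ℝ => m (ξ - η, η) * k j (phase a b c (ξ - η, η)) *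
        (hat f (ξ - η) * hat g η) := by
      intro j
      obtain ⟨M, hM⟩ := hm_supp.exists_bound_of_continuous hm
      have hM0 : 0 ≤ M := (norm_nonneg _).trans (hM 0)
      have h4 : Measurable fun η : ℝ => k j (phase a b c (ξ - η, η)) :=
        (hkm j).comp (hφ.continuous.measurable.comp (by fun_prop))
      refine (integrable_hat_mul_hat f g ξ).bdd_mul (c := M * (4 * min 1 t * 2 ^ j))
        (((by fun_prop : Measurable fun η : ℝ => m (ξ - η, η)).mul h4).aestronglyMeasurable)
        (Filter.Eventually.of_forall fun η => ?_)
      rw [norm_mul]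
      exact mul_le_mul (hM _) (hkN j _) (norm_nonneg _) hM0
    simp only [hQ, bilinearHat]
    rw [← integral_finsetSum _ (fun j _ => hint j)]
    refine integral_congr_ae (Filter.Eventually.of_forall fun η => ?_)
    simp only
    rw [← Finset.sum_mul, ← Finset.mul_sum]
    congr 1
    -- The decomposition of the oscillatory factor holds only for `|y| ≤ B`; this covers the values
    -- of the phase on the support of `m`, and elsewhere both sides vanish.
    by_cases hη : (ξ - η, η) ∈ tsupport m
    · rw [hkE _ (hφB _ hη)]
    · rw [image_eq_zero_of_notMem_tsupport hη, zero_mul, zero_mul]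
  · refine (hytop j).trans ?_
    simp only [hUn]
    refine (H _ j (k j) hA (hkm j) (hkN j) (hkδ j) f g).1.trans_eq ?_
    congr 2
    ring
  · rw [← eLpNorm_hat, eLpNorm_congr_ae (hy j), hUL]
    refine (H _ j (k j) hA (hkm j) (hkN j) (hkδ j) f g).2.trans_eq ?_
    congr 2
    ring

theorem natCast_add_one_le_jap_log {J : ℕ} {t : ℝ} (hJ : (2 : ℝ) ^ J ≤ max 1 t) :
    (J + 1 : ℝ) ≤ ((Real.log 2)⁻¹ + 1) * jap (Real.log t) := by
  have hl : 0 < Real.log 2 := Real.log_pos one_lt_two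
  have h1 : J * Real.log 2 ≤ |Real.log t| := by
    rw [← Real.log_pow]
    rcases le_total t 1 with h | h
    · rw [max_eq_left h] at hJ
      exact (Real.log_nonpos (by positivity) hJ).trans (abs_nonneg _)
    · rw [max_eq_right h] at hJ
      exact (Real.log_le_log (by positivity) hJ).trans (le_abs_self _)
  have h2 : (J : ℝ) ≤ (Real.log 2)⁻¹ * jap (Real.log t) := by
    rw [← div_eq_inv_mul, le_div_iff₀ hl]
    exact h1.trans (abs_le_jap _)
  linarith [one_le_jap (Real.log t)]

/-- For `t ≤ 1` the factor `min 1 t` of the single piece is already below `t ^ e`; this makes the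
power bound valid for short times too. -/
theorem min_mul_max_rpow_le {t e : ℝ} (ht : 0 < t) (he : e ≤ 1) :
    min 1 t * max 1 t ^ e ≤ t ^ e := by
  rcases le_total t 1 with h | h
  · rw [min_eq_right h, max_eq_left h, Real.one_rpow, mul_one]
    simpa using Real.rpow_le_rpow_of_exponent_ge ht h he
  · rw [min_eq_left h, max_eq_right h, one_mul]

/-- `L^q` bound of the solution by the sum of the bounds of its dyadic pieces. -/
theorem exists_eLpNorm_solution_le_sum {a b c : ℝ → ℝ} {m : ℝ × ℝ → ℂ}
    (ha : ContDiff ℝ 1 a) (hb : ContDiff ℝ 1 b) (hc : ContDiff ℝ 1 c) (hm : Continuous m)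
    (hm_supp : HasCompactSupport m) (hΓ : NonCharacteristicOn (phase a b c) (tsupport m))
    {s κ C₀ : ℝ} (hs : 0 ≤ s) (hsκ : 1 / 4 ≤ s + κ) (hC₀ : 0 ≤ C₀)
    (hsum : ∀ n : ℕ, ∑ k ∈ Finset.range n, (2 : ℝ) ^ ((k + 2) / 4 - s * k : ℝ)
      ≤ C₀ * 2 ^ (κ * n)) {q : ℝ} (hq : 2 ≤ q) :
    ∃ C : ℝ, 0 < C ∧ ∀ (f g : L2) (u v w : ℝ → L2), IsSolution a b c m f g u v w →
      ∀ t : ℝ, 0 < t → ∃ J : ℕ, (2 : ℝ) ^ J ≤ max 1 t ∧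
        eLpNorm (u t) (ENNReal.ofReal q) volume ≤
          ENNReal.ofReal (C * (min 1 t * ∑ j ∈ Finset.range (J + 1), ((2 : ℝ) ^ (4 * κ / q)) ^ j)) *
            weightedNorm s f * weightedNorm s g := by
  obtain ⟨C, hC, H⟩ := exists_solution_decomposition ha hb hc hm hm_supp hΓ hs hsκ hC₀ hsum
  refine ⟨C, hC, fun f g u v w hsol t ht => ?_⟩
  obtain ⟨J, y, hJ, hu, hy⟩ := H f g u v w hsol t ht
  refine ⟨J, hJ, ?_⟩
  have hmin : 0 < min 1 t := lt_min one_pos ht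
  have hq0 : 0 < q := by linarith
  have hpiece : ∀ j, eLpNorm (y j) (ENNReal.ofReal q) volume ≤
      ENNReal.ofReal (C * min 1 t * ((2 : ℝ) ^ (4 * κ / q)) ^ j) *
        (weightedNorm s f * weightedNorm s g) := by
    intro j
    -- The `L²` bound exceeds the common `L^∞` bound by the factor `2^{2κj}`, which interpolation
    -- raises to the power `2/q`.
    have h1 := eLpNorm_le_of_two_top (Lp.stronglyMeasurable (y j)).aestronglyMeasurable hq
      (X := ENNReal.ofReal (C * min 1 t) * (weightedNorm s f * weightedNorm s g))
      (l := ENNReal.ofReal (2 ^ (2 * κ * j))) (μ := volume)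
      ((hy j).2.trans_eq (by rw [mul_comm (C * _), ENNReal.ofReal_mul (by positivity), mul_assoc]))
      ((hy j).1.trans (mul_le_mul' le_rfl
        (mul_le_mul' (eLpNorm_le_weightedNorm f hs) (eLpNorm_le_weightedNorm g hs))))
    refine h1.trans_eq ?_
    rw [← mul_assoc, ENNReal.ofReal_rpow_of_pos (by positivity),
      ← ENNReal.ofReal_mul (by positivity), mul_comm (C * _)]
    congr 3
    rw [← Real.rpow_natCast (_ ^ _) j, ← Real.rpow_mul zero_le_two, ← Real.rpow_mul zero_le_two]
    congr 1
    ring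
  rw [hu]
  refine (eLpNorm_sum_coeFn_le (by
    rw [← ENNReal.ofReal_one]; exact ENNReal.ofReal_le_ofReal (by linarith)) _ _).trans ?_
  refine (Finset.sum_le_sum fun j _ => hpiece j).trans_eq ?_
  rw [← Finset.sum_mul, ← ENNReal.ofReal_sum_of_nonneg (fun j _ => by positivity),
    ← Finset.mul_sum, mul_assoc C, ← mul_assoc]

end

/-! ### The three bounds: summation over the dyadic pieces -/

theorem theorem4p2 (a b c : ℝ → ℝ) (m : ℝ × ℝ → ℂ)
    (ha : ContDiff ℝ ∞ a) (hb : ContDiff ℝ ∞ b) (hc : ContDiff ℝ ∞ c)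
    (hm : ContDiff ℝ ∞ m) (hm_supp : HasCompactSupport m)
    (hφ : VanishesToFirstOrderOn (phase a b c) (tsupport m))
    (hΓ : NonCharacteristicOn (phase a b c) (tsupport m)) :
    (∀ q s : ℝ, 2 ≤ q → 0 ≤ s → s < 1 / 4 →
      ∃ C : ℝ, 0 < C ∧ ∀ (f g : L2) (u v w : ℝ → L2), IsSolution a b c m f g u v w →
        ∀ t : ℝ, 0 < t →
          eLpNorm (u t) (ENNReal.ofReal q) volume ≤
            ENNReal.ofReal (C * t ^ ((1 - 4 * s) / q)) * weightedNorm s f * weightedNorm s g) ∧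
    (∀ q s : ℝ, 2 ≤ q → 1 / 4 < s →
      ∃ C : ℝ, 0 < C ∧ ∀ (f g : L2) (u v w : ℝ → L2), IsSolution a b c m f g u v w →
        ∀ t : ℝ, 0 < t →
          eLpNorm (u t) (ENNReal.ofReal q) volume ≤
            ENNReal.ofReal (C * jap (Real.log t)) * weightedNorm s f * weightedNorm s g) ∧
    (∃ C : ℝ, 0 < C ∧ ∀ (f g : L2) (u v w : ℝ → L2), IsSolution a b c m f g u v w →
        ∀ t : ℝ, 0 < t →
          eLpNorm (u t) ⊤ volume ≤
            ENNReal.ofReal (C * jap (Real.log t)) *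
              eLpNorm f 2 volume * eLpNorm g 2 volume) := by
  have ha1 : ContDiff ℝ 1 a := ha.of_le (by exact_mod_cast le_top)
  have hb1 : ContDiff ℝ 1 b := hb.of_le (by exact_mod_cast le_top)
  have hc1 : ContDiff ℝ 1 c := hc.of_le (by exact_mod_cast le_top)
  have hl : 0 < Real.log 2 := Real.log_pos one_lt_two
  refine ⟨fun q s hq hs hs4 => ?_, fun q s hq hs4 => ?_, ?_⟩
  · have hq0 : 0 < q := by linarith
    obtain ⟨C₀, hC₀, hsum⟩ := sum_rpow_le_of_lt hs4
    obtain ⟨C, hC, H⟩ := exists_eLpNorm_solution_le_sum ha1 hb1 hc1 hm.continuous hm_supp hΓ hs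
      (by linarith) hC₀ hsum hq
    set e := (1 - 4 * s) / q with he
    have he' : 4 * (1 / 4 - s) / q = e := by rw [he]; ring
    have he0 : 0 < e := div_pos (by linarith) hq0
    have he1 : e ≤ 1 := by rw [he, div_le_one hq0]; linarith
    set x : ℝ := 2 ^ e with hx
    have hx1 : 1 < x := Real.one_lt_rpow one_lt_two he0
    have hx2 : 0 < x - 1 := by linarith
    refine ⟨C * (x / (x - 1)), by positivity, fun f g u v w hsol t ht => ?_⟩
    obtain ⟨J, hJ, hle⟩ := H f g u v w hsol t ht
    refine hle.trans ?_
    rw [he']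
    gcongr ENNReal.ofReal ?_ * _ * _
    have hmin : 0 < min 1 t := lt_min one_pos ht
    -- With ratio `x = 2^e > 1` the geometric sum is comparable to its last term, and `x^J = (2^J)^e
    -- ≤ max(1,t)^e`.
    have h1 : ∑ j ∈ Finset.range (J + 1), x ^ j ≤ x / (x - 1) * max 1 t ^ e := by
      rw [geom_sum_eq hx1.ne', div_mul_eq_mul_div]
      gcongr
      have h2 : x ^ J ≤ max 1 t ^ e := by
        rw [hx, ← Real.rpow_natCast, ← Real.rpow_mul two_pos.le, mul_comm, Real.rpow_mul two_pos.le,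
          Real.rpow_natCast]
        exact Real.rpow_le_rpow (by positivity) hJ he0.le
      rw [pow_succ']
      nlinarith
    calc C * (min 1 t * ∑ j ∈ Finset.range (J + 1), x ^ j)
        ≤ C * (min 1 t * (x / (x - 1) * max 1 t ^ e)) := by gcongr
      _ = C * (x / (x - 1)) * (min 1 t * max 1 t ^ e) := by ring
      _ ≤ _ := by
        gcongr
        exact min_mul_max_rpow_le ht he1
  · obtain ⟨C₀, hC₀, hsum⟩ := sum_rpow_le_of_gt hs4
    obtain ⟨C, hC, H⟩ := exists_eLpNorm_solution_le_sum ha1 hb1 hc1 hm.continuous hm_supp hΓ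
      (by linarith) (by linarith) hC₀ hsum hq
    refine ⟨C * ((Real.log 2)⁻¹ + 1), by positivity, fun f g u v w hsol t ht => ?_⟩
    obtain ⟨J, hJ, hle⟩ := H f g u v w hsol t ht
    refine hle.trans ?_
    gcongr ENNReal.ofReal ?_ * _ * _
    rw [mul_assoc C]
    refine mul_le_mul_of_nonneg_left ?_ hC.le
    -- Here `κ = 0`: the ratio is 1 and the sum is the number `J + 1` of pieces.
    simp only [mul_zero, zero_div, Real.rpow_zero, one_pow, Finset.sum_const, Finset.card_range,
      nsmul_eq_mul, mul_one]
    push_cast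
    refine (mul_le_of_le_one_left (by positivity) (min_le_left _ _)).trans ?_
    exact natCast_add_one_le_jap_log hJ
  -- Only the uniform `L^∞` bounds are used, so the choice `s = 0` is a matter of convenience.
  · obtain ⟨C₀, hC₀, hsum⟩ := sum_rpow_le_of_lt (s := 0) (by norm_num)
    obtain ⟨C, hC, H⟩ := exists_solution_decomposition ha1 hb1 hc1 hm.continuous hm_supp hΓ
      le_rfl (by norm_num) hC₀ hsum
    refine ⟨C * ((Real.log 2)⁻¹ + 1), by positivity, fun f g u v w hsol t ht => ?_⟩
    obtain ⟨J, y, hJ, hu, hy⟩ := H f g u v w hsol t ht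
    rw [hu]
    refine (eLpNorm_sum_coeFn_le le_top _ _).trans
      ((Finset.sum_le_sum fun j _ => (hy j).1).trans ?_)
    rw [Finset.sum_const, Finset.card_range, nsmul_eq_mul, ← mul_assoc, ← mul_assoc,
      ← ENNReal.ofReal_natCast, ← ENNReal.ofReal_mul (by positivity)]
    gcongr ENNReal.ofReal ?_ * _ * _
    have h1 := natCast_add_one_le_jap_log hJ
    have hmin : 0 < min 1 t := lt_min one_pos ht
    have h2 : 0 ≤ ((Real.log 2)⁻¹ + 1) * jap (Real.log t) := le_trans (by positivity) h1
    push_cast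
    calc ((J : ℝ) + 1) * (C * min 1 t)
        ≤ (((Real.log 2)⁻¹ + 1) * jap (Real.log t)) * (C * 1) := by
          gcongr
          exact min_le_left _ _
      _ = _ := by ring
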